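/- Let $E$ be a Dedekind complete Riesz space (real vector lattice) with weak order unit $e$. A conditional expectation operator on $E$ is a positive order continuous linear projection $T:E\to E$ whose range $R(T)$ is a Dedekind complete Riesz subspace of $E$ and which maps every weak order unit of $E$ to a weak order unit of $E$. A conditional expectation preserving system $(E,T,S,e)$ consists of such an $E$ and $e$, a conditional expectation operator $T$ on $E$ with $Te=e$, and an order continuous Riesz homomorphism $S:E\to E$ with $Se=e$ and $TSPe=TPe$ for every band projection $P$ on $E$. For $f\in E$ put $S_nf=\frac1n\sum_{k=0}^{n-1}S^kf$ for $n\ge 1$, and let $L_Sf$ be the order limit of $(S_nf)_{n\ge1}$ when it exists. The system is called ergodic if for every $f\in E$ with $Sf=f$ the limit $L_Sf$ exists and lies in $R(T)$. Let $E_e=\{f\in E: |f|\le ke \text{ for some } k\in[0,\infty)\}$, with its $f$-algebra multiplication $\cdot$, i.e. the one with unit $e$ determined by $Pe\cdot Qe=PQe$ for all band projections $P,Q$ on $E$, extended to $E_e$ bilinearly and by order limits. Theorem. Let $(E,T,S,e)$ be a conditional expectation preserving system with $T$ strictly positive, that is, $T$ is positive and, for $f\ge 0$, $Tf=0$ only if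 $f=0$. Then $(E,T,S,e)$ is ergodic if and only if, for all $f,g\in E_e$, $$\frac1n\sum_{k=0}^{n-1}T\big((S^kf)\cdot g\big)\longrightarrow Tf\cdot Tg\quad\text{in order, as } n\to\infty .$$ -/

import Mathlib

open Filter

set_option linter.unusedSectionVars false

namespace RieszErgodic

/-! Throughout, `E` is a Dedekind complete Riesz space: an ordered real vector space that is a
lattice in which every nonempty set bounded above has a supremum. -/

section Definitions

variable {E : Type*} [ConditionallyCompleteLattice E] [AddCommGroup E] [IsOrderedAddMonoid E]
  [Module ℝ E] [IsOrderedModule ℝ E]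

/-- `e ≥ 0` is a weak order unit: only `0` is disjoint from `e` (equivalently, as `E` is
Archimedean, the band generated by `e` is `E`). -/
def IsWeakOrderUnit (e : E) : Prop :=
  0 ≤ e ∧ ∀ x : E, 0 ≤ x → e ⊓ x = 0 → x = 0

/-- Positivity of an operator. -/
def IsPositive (A : E →ₗ[ℝ] E) : Prop := ∀ x : E, 0 ≤ x → 0 ≤ A x

/-- Order continuity of a positive operator: `x_α ↓ 0` implies `A x_α ↓ 0`, for nets `x_α`
(equivalently, for downward directed sets). -/
def IsOrderContinuous (A : E →ₗ[ℝ] E) : Prop :=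
  ∀ D : Set E, D.Nonempty → DirectedOn (· ≥ ·) D → IsGLB D 0 → IsGLB (A '' D) 0

/-- A set is a Dedekind complete sublattice of `E`: it is closed under the lattice operations of
`E`, and each nonempty subset with an upper bound in it has a least upper bound within it. -/
def IsDedekindCompleteSublattice (R : Set E) : Prop :=
  (∀ x ∈ R, ∀ y ∈ R, x ⊔ y ∈ R ∧ x ⊓ y ∈ R) ∧
  ∀ A ⊆ R, A.Nonempty → (∃ b ∈ R, ∀ a ∈ A, a ≤ b) →
    ∃ s ∈ R, (∀ a ∈ A, a ≤ s) ∧ ∀ b ∈ R, (∀ a ∈ A, a ≤ b) → s ≤ b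

/-- Conditional expectation operators on `E`: positive order continuous projections whose range is
a Dedekind complete Riesz subspace and which map weak order units to weak order units. -/
structure IsConditionalExpectation (T : E →ₗ[ℝ] E) : Prop where
  positive : IsPositive T
  orderContinuous : IsOrderContinuous T
  projection : ∀ x, T (T x) = T x
  range_complete : IsDedekindCompleteSublattice (Set.range T)
  map_weakOrderUnit : ∀ u : E, IsWeakOrderUnit u → IsWeakOrderUnit (T u)

/-- Band projections: the linear idempotents `P` with `0 ≤ P ≤ I`. -/
def IsBandProjection (P : E →ₗ[ℝ] E) : Prop :=
  (∀ x, P (P x) = P x) ∧ ∀ x, 0 ≤ x → 0 ≤ P x ∧ P x ≤ x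

/-- Conditional expectation preserving systems `(E,T,S,e)`. -/
structure IsCondExpPreservingSystem (T S : E →ₗ[ℝ] E) (e : E) : Prop where
  weakOrderUnit : IsWeakOrderUnit e
  condExp : IsConditionalExpectation T
  T_unit : T e = e
  S_latticeHom : ∀ x y, S (x ⊔ y) = S x ⊔ S y
  S_orderContinuous : IsOrderContinuous S
  S_unit : S e = e
  preserving : ∀ P : E →ₗ[ℝ] E, IsBandProjection P → T (S (P e)) = T (P e)

/-- Strict positivity: `A` is positive and, on the positive cone, vanishes only at `0`. -/
def IsStrictlyPositive (A : E →ₗ[ℝ] E) : Prop :=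
  IsPositive A ∧ ∀ x : E, 0 ≤ x → (A x = 0 ↔ x = 0)

/-- Order convergence of a sequence: `|xₙ - l| ≤ uₙ` (for all large `n`) for some `uₙ ↓ 0`.
Finitely many terms have no influence on the limit. -/
def OrderTendsto (x : ℕ → E) (l : E) : Prop :=
  ∃ u : ℕ → E, Antitone u ∧ IsGLB (Set.range u) 0 ∧ ∀ᶠ n in atTop, |x n - l| ≤ u n

/-- The Cesàro means `S_n f = (1/n) ∑_{k<n} S^k f` (of interest for `n ≥ 1`). -/
noncomputable def cesaro (S : E →ₗ[ℝ] E) (f : E) (n : ℕ) : E :=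
  (n : ℝ)⁻¹ • ∑ k ∈ Finset.range n, (S ^ k) f

/-- Ergodicity: `L_S f`, the order limit of the `S_n f`, lies in the range of `T` for each
`S`-invariant `f`. -/
def IsErgodic (T S : E →ₗ[ℝ] E) : Prop :=
  ∀ f : E, S f = f → ∃ l ∈ Set.range T, OrderTendsto (cesaro S f) l

/-- `E_e`, the space of `e`-bounded elements. -/
def bounded (e : E) : Set E := {f | ∃ k : ℝ, 0 ≤ k ∧ |f| ≤ k • e}

/-- The square `f · f` in the `f`-algebra `E_e`: as `(f - c e) · (f - c e) ≥ 0`, it is the supremum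
of the elements `2 c f - c² e` over all real `c`. -/
noncomputable def eSq (e f : E) : E := ⨆ c : ℝ, ((2 * c) • f - c ^ 2 • e)

/-- The `f`-algebra multiplication on `E_e` with unit `e`, obtained from the squares by
polarization. It is the one determined by `Pe · Qe = PQe` for band projections `P`, `Q`, by
bilinearity, and by passage to order limits: see `eMul_bandProjection`, `eMul_add_left`,
`eMul_smul_left`, `eMul_comm` and `eMul_orderTendsto` below. -/
noncomputable def eMul (e f g : E) : E := (4 : ℝ)⁻¹ • (eSq e (f + g) - eSq e (f - g))

end Definitions

/-! The laws of the multiplication on `E_e`. -/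

section Multiplication

variable {E : Type*} [ConditionallyCompleteLattice E] [AddCommGroup E] [IsOrderedAddMonoid E]
  [Module ℝ E] [IsOrderedModule ℝ E]

theorem abs_smul_le (t : ℝ) (f : E) : |t • f| ≤ |t| • |f| := by
  rcases le_total 0 t with h | h
  · rw [abs_of_nonneg h]
    refine abs_le'.2 ⟨smul_le_smul_of_nonneg_left (le_abs_self f) h, ?_⟩
    rw [← smul_neg]
    exact smul_le_smul_of_nonneg_left (neg_le_abs f) h
  · rw [abs_of_nonpos h]
    have h' : 0 ≤ -t := by linarith
    refine abs_le'.2 ⟨?_, ?_⟩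
    · have : t • f = (-t) • (-f) := by module
      rw [this]
      exact smul_le_smul_of_nonneg_left (neg_le_abs f) h'
    · rw [← neg_smul]
      exact smul_le_smul_of_nonneg_left (le_abs_self f) h'

theorem bounded_add {e f g : E} (hf : f ∈ bounded e) (hg : g ∈ bounded e) :
    f + g ∈ bounded e := by
  obtain ⟨k, hk, hf⟩ := hf
  obtain ⟨l, hl, hg⟩ := hg
  refine ⟨k + l, by positivity, (abs_add_le f g).trans ?_⟩
  rw [add_smul]
  exact add_le_add hf hg

theorem bounded_smul {e f : E} (t : ℝ) (hf : f ∈ bounded e) : t • f ∈ bounded e := by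
  obtain ⟨k, hk, hf⟩ := hf
  refine ⟨|t| * k, by positivity, (abs_smul_le t f).trans ?_⟩
  rw [mul_smul]
  exact smul_le_smul_of_nonneg_left hf (abs_nonneg t)

theorem bounded_neg {e f : E} (hf : f ∈ bounded e) : -f ∈ bounded e := by
  obtain ⟨k, hk, hf⟩ := hf
  exact ⟨k, hk, by rwa [abs_neg]⟩

theorem bounded_sub {e f g : E} (hf : f ∈ bounded e) (hg : g ∈ bounded e) :
    f - g ∈ bounded e := by
  rw [sub_eq_add_neg]; exact bounded_add hf (bounded_neg hg)

theorem bounded_of_abs_le {e f g : E} (hg : g ∈ bounded e) (h : |f| ≤ |g|) : f ∈ bounded e := by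
  obtain ⟨k, hk, hg⟩ := hg
  exact ⟨k, hk, h.trans hg⟩

theorem unit_bounded {e : E} (he : 0 ≤ e) : e ∈ bounded e :=
  ⟨1, zero_le_one, by rw [abs_of_nonneg he, one_smul]⟩

theorem isLUB_eSq {e f : E} (he : 0 ≤ e) (hf : f ∈ bounded e) :
    IsLUB (Set.range fun c : ℝ => (2 * c) • f - c ^ 2 • e) (eSq e f) := by
  obtain ⟨k, hk, hf⟩ := hf
  refine isLUB_ciSup ⟨k ^ 2 • e, ?_⟩
  rintro _ ⟨c, rfl⟩
  have h1 : (2 * c) • f ≤ (|2 * c| * k) • e := by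
    rw [mul_smul |2 * c|]
    exact (le_abs_self _).trans ((abs_smul_le _ f).trans
      (smul_le_smul_of_nonneg_left hf (abs_nonneg _)))
  calc (2 * c) • f - c ^ 2 • e ≤ (|2 * c| * k) • e - c ^ 2 • e := sub_le_sub_right h1 _
    _ = (|2 * c| * k - c ^ 2) • e := by rw [sub_smul]
    _ ≤ k ^ 2 • e := by
      refine smul_le_smul_of_nonneg_right ?_ he
      rw [abs_mul, abs_two]
      nlinarith [sq_nonneg (|c| - k), sq_abs c]

theorem le_eSq {e f : E} (he : 0 ≤ e) (hf : f ∈ bounded e) (c : ℝ) :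
    (2 * c) • f - c ^ 2 • e ≤ eSq e f :=
  (isLUB_eSq he hf).1 ⟨c, rfl⟩

theorem eSq_le {e f x : E} (he : 0 ≤ e) (hf : f ∈ bounded e)
    (h : ∀ c : ℝ, (2 * c) • f - c ^ 2 • e ≤ x) : eSq e f ≤ x :=
  (isLUB_eSq he hf).2 (by rintro _ ⟨c, rfl⟩; exact h c)

theorem eSq_nonneg {e f : E} (he : 0 ≤ e) (hf : f ∈ bounded e) : 0 ≤ eSq e f := by
  simpa using le_eSq he hf 0

theorem eSq_zero {e : E} (he : 0 ≤ e) : eSq e 0 = 0 := by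
  have h0 : (0 : E) ∈ bounded e := ⟨0, le_rfl, by simp⟩
  refine le_antisymm (eSq_le he h0 fun c => ?_) (eSq_nonneg he h0)
  simpa using smul_nonneg (sq_nonneg c) he

theorem eSq_neg (e f : E) : eSq e (-f) = eSq e f := by
  refine (Equiv.neg ℝ).iSup_congr fun c => ?_
  simp

/-- The parallelogram law. -/
theorem eSq_parallelogram {e f g : E} (he : 0 ≤ e) (hf : f ∈ bounded e) (hg : g ∈ bounded e) :
    eSq e (f + g) + eSq e (f - g) = (2 : ℝ) • (eSq e f + eSq e g) := by
  have hs := bounded_add hf hg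
  have hd := bounded_sub hf hg
  refine le_antisymm ?_ ?_
  · rw [← le_sub_iff_add_le]
    refine eSq_le he hs fun p => ?_
    rw [le_sub_comm]
    refine eSq_le he hd fun q => ?_
    rw [le_sub_iff_add_le]
    have h1 := add_le_add (le_eSq he hf ((p + q) / 2)) (le_eSq he hg ((p - q) / 2))
    refine le_of_eq_of_le ?_ (smul_le_smul_of_nonneg_left h1 (zero_le_two (α := ℝ)))
    module
  · suffices h : eSq e f + eSq e g ≤ (2 : ℝ)⁻¹ • (eSq e (f + g) + eSq e (f - g)) by
      refine (smul_le_smul_of_nonneg_left h (zero_le_two (α := ℝ))).trans (le_of_eq ?_)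
      module
    rw [← le_sub_iff_add_le]
    refine eSq_le he hf fun c => ?_
    rw [le_sub_comm]
    refine eSq_le he hg fun d => ?_
    rw [le_sub_iff_add_le]
    have h1 := add_le_add (le_eSq he hs (c + d)) (le_eSq he hd (c - d))
    refine le_of_eq_of_le ?_
      (smul_le_smul_of_nonneg_left h1 (by norm_num : (0 : ℝ) ≤ (2 : ℝ)⁻¹))
    module

theorem eMul_comm (e f g : E) : eMul e f g = eMul e g f := by
  rw [eMul, eMul, add_comm f g, ← neg_sub g f, eSq_neg]

theorem eMul_self {e f : E} (he : 0 ≤ e) (hf : f ∈ bounded e) : eMul e f f = eSq e f := by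
  have h := eSq_parallelogram he hf hf
  rw [sub_self, eSq_zero he, add_zero] at h
  rw [eMul, sub_self, eSq_zero he, sub_zero, h]
  module

theorem zero_eMul (e g : E) : eMul e 0 g = 0 := by
  rw [eMul, zero_add, zero_sub, eSq_neg, sub_self, smul_zero]

theorem eMul_add_sub {e f h g : E} (he : 0 ≤ e) (hf : f ∈ bounded e) (hh : h ∈ bounded e)
    (hg : g ∈ bounded e) : eMul e (f + h) g + eMul e (f - h) g = (2 : ℝ) • eMul e f g := by
  have h1 := eSq_parallelogram he (bounded_add hf hg) hh
  have h2 := eSq_parallelogram he (bounded_sub hf hg) hh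
  rw [show f + g + h = f + h + g by abel, show f + g - h = f - h + g by abel] at h1
  rw [show f - g + h = f + h - g by abel, show f - g - h = f - h - g by abel] at h2
  simp only [eMul]
  have h3 := congrArg₂ (· - ·) h1 h2
  rw [← smul_add, smul_comm]
  congr 1
  calc _ = (eSq e (f + h + g) + eSq e (f - h + g)) - (eSq e (f + h - g) + eSq e (f - h - g)) := by abel
    _ = _ := by rw [h3]; module

theorem eMul_add_left {e f h g : E} (he : 0 ≤ e) (hf : f ∈ bounded e) (hh : h ∈ bounded e)
    (hg : g ∈ bounded e) : eMul e (f + h) g = eMul e f g + eMul e h g := by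
  have dbl : ∀ a ∈ bounded e, eMul e (a + a) g = (2 : ℝ) • eMul e a g := by
    intro a ha
    have := eMul_add_sub he ha ha hg
    rwa [sub_self, zero_eMul, add_zero] at this
  set a : E := (2 : ℝ)⁻¹ • (f + h) with ha
  set b : E := (2 : ℝ)⁻¹ • (f - h) with hb
  have ha' : a ∈ bounded e := bounded_smul _ (bounded_add hf hh)
  have hb' : b ∈ bounded e := bounded_smul _ (bounded_sub hf hh)
  have h1 := eMul_add_sub he ha' hb' hg
  rw [← dbl a ha'] at h1
  have e1 : a + b = f := by rw [ha, hb]; module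
  have e2 : a - b = h := by rw [ha, hb]; module
  have e3 : a + a = f + h := by rw [ha]; module
  rw [e1, e2, e3] at h1
  exact h1.symm

theorem neg_eMul {e f g : E} (he : 0 ≤ e) (hf : f ∈ bounded e) (hg : g ∈ bounded e) :
    eMul e (-f) g = -eMul e f g := by
  have := eMul_add_left he hf (bounded_neg hf) hg
  rw [add_neg_cancel, zero_eMul] at this
  exact (neg_eq_of_add_eq_zero_right this.symm).symm

theorem eMul_sub_left {e f h g : E} (he : 0 ≤ e) (hf : f ∈ bounded e) (hh : h ∈ bounded e)
    (hg : g ∈ bounded e) : eMul e (f - h) g = eMul e f g - eMul e h g := by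
  rw [sub_eq_add_neg, eMul_add_left he hf (bounded_neg hh) hg, neg_eMul he hh hg, sub_eq_add_neg]

theorem eMul_sub_right {e f h g : E} (he : 0 ≤ e) (hf : f ∈ bounded e) (hh : h ∈ bounded e)
    (hg : g ∈ bounded e) : eMul e g (f - h) = eMul e g f - eMul e g h := by
  rw [eMul_comm, eMul_sub_left he hf hh hg, eMul_comm e f, eMul_comm e h]

/-- Products of positive elements are positive. -/
theorem eMul_nonneg {e f g : E} (he : 0 ≤ e) (hf : f ∈ bounded e) (hg : g ∈ bounded e)
    (hf0 : 0 ≤ f) (hg0 : 0 ≤ g) : 0 ≤ eMul e f g := by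
  refine smul_nonneg (by norm_num) (sub_nonneg.2 (eSq_le he (bounded_sub hf hg) fun c => ?_))
  refine le_trans ?_ (le_eSq he (bounded_add hf hg) |c|)
  rw [sq_abs]
  refine sub_le_sub_right ?_ _
  have h1 : |f - g| ≤ f + g :=
    abs_le'.2 ⟨by rw [sub_eq_add_neg]; gcongr; exact (neg_nonpos.2 hg0).trans hg0,
      by rw [neg_sub, sub_eq_add_neg, add_comm]; gcongr; exact (neg_nonpos.2 hf0).trans hf0⟩
  calc (2 * c) • (f - g) ≤ |(2 * c) • (f - g)| := le_abs_self _
    _ ≤ |2 * c| • |f - g| := abs_smul_le _ _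
    _ ≤ |2 * c| • (f + g) := smul_le_smul_of_nonneg_left h1 (abs_nonneg _)
    _ = (2 * |c|) • (f + g) := by rw [abs_mul, abs_two]

theorem eMul_smul_unit {e f : E} (he : 0 ≤ e) (hf : f ∈ bounded e) (k : ℝ) :
    eMul e f (k • e) = k • f := by
  have key : ∀ l : ℝ, eSq e (f + l • e) ≤ eSq e f + (2 * l) • f + l ^ 2 • e := by
    intro l
    refine eSq_le he (bounded_add hf (bounded_smul l (unit_bounded he))) fun c => ?_
    have h := add_le_add_left (le_eSq he hf (c - l)) ((2 * l) • f + l ^ 2 • e)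
    rw [add_assoc]
    refine le_of_eq_of_le ?_ h
    module
  have key' : ∀ l : ℝ, eSq e f + (2 * l) • f + l ^ 2 • e ≤ eSq e (f + l • e) := by
    intro l
    rw [add_assoc, ← le_sub_iff_add_le]
    refine eSq_le he hf fun c => ?_
    rw [le_sub_iff_add_le]
    refine le_of_eq_of_le ?_
      (le_eSq he (bounded_add hf (bounded_smul l (unit_bounded he))) (c + l))
    module
  have h1 := le_antisymm (key k) (key' k)
  have h2 := le_antisymm (key (-k)) (key' (-k))
  rw [neg_smul, ← sub_eq_add_neg] at h2
  rw [eMul, h1, h2]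
  module

/-- `e` is the unit. -/
theorem eMul_unit {e f : E} (he : 0 ≤ e) (hf : f ∈ bounded e) : eMul e f e = f := by
  simpa using eMul_smul_unit he hf 1

theorem eMul_le {e f g : E} {k : ℝ} (he : 0 ≤ e) (hf : f ∈ bounded e) (hg : g ∈ bounded e)
    (hf0 : 0 ≤ f) (h : g ≤ k • e) : eMul e f g ≤ k • f := by
  have hk := bounded_smul k (unit_bounded he)
  have := eMul_nonneg he hf (bounded_sub hk hg) hf0 (sub_nonneg.2 h)
  rw [eMul_sub_right he hk hg hf, eMul_smul_unit he hf] at this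
  exact sub_nonneg.1 this

theorem abs_eMul_le {e f g : E} {k : ℝ} (he : 0 ≤ e) (hf : f ∈ bounded e)
    (hk : 0 ≤ k) (h : |g| ≤ k • e) : |eMul e f g| ≤ k • |f| := by
  have hg : g ∈ bounded e := ⟨k, hk, h⟩
  have main : ∀ a ∈ bounded e, 0 ≤ a → |eMul e a g| ≤ k • a := by
    intro a ha ha0
    refine abs_le'.2 ⟨eMul_le he ha hg ha0 ((le_abs_self g).trans h), ?_⟩
    rw [eMul_comm, ← neg_eMul he hg ha, eMul_comm]
    exact eMul_le he ha (bounded_neg hg) ha0 ((neg_le_abs g).trans h)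
  have hp : f⁺ ∈ bounded e := bounded_of_abs_le hf
    (by rw [abs_of_nonneg (posPart_nonneg f)]; rw [← posPart_add_negPart]; exact le_add_of_nonneg_right (negPart_nonneg f))
  have hn : f⁻ ∈ bounded e := bounded_of_abs_le hf
    (by rw [abs_of_nonneg (negPart_nonneg f)]; rw [← posPart_add_negPart]; exact le_add_of_nonneg_left (posPart_nonneg f))
  calc |eMul e f g| = |eMul e f⁺ g - eMul e f⁻ g| := by
        rw [← eMul_sub_left he hp hn hg, posPart_sub_negPart]
    _ ≤ |eMul e f⁺ g| + |eMul e f⁻ g| := by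
        rw [sub_eq_add_neg, ← abs_neg (eMul e f⁻ g)]; exact abs_add_le _ _
    _ ≤ k • f⁺ + k • f⁻ :=
        add_le_add (main _ hp (posPart_nonneg f)) (main _ hn (negPart_nonneg f))
    _ = k • |f| := by rw [← smul_add, posPart_add_negPart]

/-- `E_e` is closed under multiplication. -/
theorem eMul_mem {e f g : E} (he : 0 ≤ e) (hf : f ∈ bounded e) (hg : g ∈ bounded e) :
    eMul e f g ∈ bounded e := by
  obtain ⟨k, hk, h⟩ := hg
  obtain ⟨l, hl, h'⟩ := hf
  refine ⟨k * l, by positivity, (abs_eMul_le he ⟨l, hl, h'⟩ hk h).trans ?_⟩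
  rw [mul_smul]
  exact smul_le_smul_of_nonneg_left h' hk

/-- A Dedekind complete Riesz space is Archimedean. -/
theorem le_zero_of_nat_smul_le {x y : E} (h : ∀ n : ℕ, (n : ℝ) • x ≤ y) : x ≤ 0 := by
  have hb : BddAbove (Set.range fun n : ℕ => (n : ℝ) • x) := ⟨y, by rintro _ ⟨n, rfl⟩; exact h n⟩
  have h1 : (⨆ n : ℕ, (n : ℝ) • x) ≤ (⨆ n : ℕ, (n : ℝ) • x) - x := by
    refine ciSup_le fun n => ?_
    rw [le_sub_iff_add_le]
    refine le_of_eq_of_le ?_ (le_ciSup hb (n + 1))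
    push_cast
    module
  simpa using h1

theorem eMul_smul_left {e f g : E} (he : 0 ≤ e) (hf : f ∈ bounded e) (hg : g ∈ bounded e) (t : ℝ) :
    eMul e (t • f) g = t • eMul e f g := by
  obtain ⟨k, hk, hgk⟩ := id hg
  let φ : ℝ →+ E :=
    { toFun := fun s => eMul e (s • f) g - s • eMul e f g
      map_zero' := by simp [zero_eMul]
      map_add' := fun a b => by
        rw [add_smul, add_smul, eMul_add_left he (bounded_smul a hf) (bounded_smul b hf) hg]
        abel }
  have hφ1 : φ 1 = 0 := by simp [φ]
  have hφb : ∀ s : ℝ, |φ s| ≤ |s| • ((2 * k) • |f|) := by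
    intro s
    have h1 : |eMul e (s • f) g| ≤ k • (|s| • |f|) :=
      (abs_eMul_le he (bounded_smul s hf) hk hgk).trans
        (smul_le_smul_of_nonneg_left (abs_smul_le s f) hk)
    have h2 : |s • eMul e f g| ≤ |s| • (k • |f|) :=
      (abs_smul_le s _).trans (smul_le_smul_of_nonneg_left (abs_eMul_le he hf hk hgk) (abs_nonneg s))
    calc |φ s| = |eMul e (s • f) g + -(s • eMul e f g)| := by
          rw [← sub_eq_add_neg]; rfl
      _ ≤ |eMul e (s • f) g| + |-(s • eMul e f g)| := abs_add_le _ _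
      _ ≤ k • (|s| • |f|) + |s| • (k • |f|) := by rw [abs_neg]; exact add_le_add h1 h2
      _ = _ := by module
  have hφz : ∀ m : ℤ, φ m = 0 := by
    intro m
    have := map_zsmul φ m 1
    rwa [hφ1, smul_zero, zsmul_eq_mul, mul_one] at this
  have hφ : ∀ s : ℝ, φ s ≤ 0 := by
    intro s
    refine le_zero_of_nat_smul_le (y := (2 * k) • |f|) fun n => ?_
    have h1 : (n : ℝ) • φ s = φ (Int.fract (n * s)) := by
      have h2 := map_nsmul φ n s
      rw [nsmul_eq_mul, ← Int.floor_add_fract (n * s), map_add, hφz, zero_add] at h2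
      rw [h2, Nat.cast_smul_eq_nsmul]
    rw [h1]
    refine (le_abs_self _).trans ((hφb _).trans ?_)
    have h3 : 0 ≤ (2 * k) • |f| := smul_nonneg (by positivity) (abs_nonneg f)
    have h4 : |Int.fract ((n : ℝ) * s)| ≤ 1 := by
      rw [abs_of_nonneg (Int.fract_nonneg _)]; exact (Int.fract_lt_one _).le
    simpa using smul_le_smul_of_nonneg_right h4 h3
  have h0 : φ t = 0 := by
    refine le_antisymm (hφ t) ?_
    have := hφ (-t)
    rwa [map_neg, neg_nonpos] at this
  exact sub_eq_zero.1 h0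

theorem smul_inf_smul_eq_zero {a b : E} (h : a ⊓ b = 0) (k : ℝ) (hk : 0 ≤ k) :
    k • a ⊓ k • b = 0 := by
  rcases hk.eq_or_lt with rfl | hk
  · simp
  have h0 : 0 ≤ a ⊓ b := h.ge
  refine le_antisymm ?_ (le_inf (smul_nonneg hk.le (h0.trans inf_le_left))
    (smul_nonneg hk.le (h0.trans inf_le_right)))
  have h1 : k⁻¹ • (k • a ⊓ k • b) ≤ a ⊓ b := by
    refine le_inf ?_ ?_
    · refine (smul_le_smul_of_nonneg_left inf_le_left (inv_nonneg.2 hk.le)).trans (le_of_eq ?_)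
      rw [inv_smul_smul₀ hk.ne']
    · refine (smul_le_smul_of_nonneg_left inf_le_right (inv_nonneg.2 hk.le)).trans (le_of_eq ?_)
      rw [inv_smul_smul₀ hk.ne']
  have h2 := smul_le_smul_of_nonneg_left h1 hk.le
  rwa [smul_inv_smul₀ hk.ne', h, smul_zero] at h2

/-- Disjoint elements have product zero. -/
theorem eMul_eq_zero_of_disjoint {e f g : E} (he : 0 ≤ e) (hf : f ∈ bounded e)
    (hg : g ∈ bounded e) (h : f ⊓ g = 0) : eMul e f g = 0 := by
  have hf0 : 0 ≤ f := h.ge.trans inf_le_left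
  have hg0 : 0 ≤ g := h.ge.trans inf_le_right
  obtain ⟨k, hk, hfk⟩ := id hf
  obtain ⟨l, hl, hgl⟩ := id hg
  refine le_antisymm ?_ (eMul_nonneg he hf hg hf0 hg0)
  rw [← smul_inf_smul_eq_zero h (max k l) (hk.trans (le_max_left k l))]
  refine le_inf ?_ ?_
  · exact eMul_le he hf hg hf0 (((le_abs_self g).trans hgl).trans
      (smul_le_smul_of_nonneg_right (le_max_right k l) he))
  · rw [eMul_comm]
    exact eMul_le he hg hf hg0 (((le_abs_self f).trans hfk).trans
      (smul_le_smul_of_nonneg_right (le_max_left k l) he))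

/-- The `f`-algebra property. -/
theorem eMul_inf_eq_zero {e f g h : E} (he : 0 ≤ e) (hf : f ∈ bounded e)
    (hh : h ∈ bounded e) (hh0 : 0 ≤ h) (hfg : f ⊓ g = 0) : eMul e f h ⊓ g = 0 := by
  have hf0 : 0 ≤ f := hfg.ge.trans inf_le_left
  have hg0 : 0 ≤ g := hfg.ge.trans inf_le_right
  obtain ⟨k, hk, hhk⟩ := id hh
  refine le_antisymm ?_ (le_inf (eMul_nonneg he hf hh hf0 hh0) hg0)
  rw [← smul_inf_smul_eq_zero hfg (max k 1) (hk.trans (le_max_left k 1))]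
  refine inf_le_inf ?_ ?_
  · exact eMul_le he hf hh hf0 (((le_abs_self h).trans hhk).trans
      (smul_le_smul_of_nonneg_right (le_max_left k 1) he))
  · simpa using smul_le_smul_of_nonneg_right (le_max_right k 1) hg0

theorem IsBandProjection.disjoint {P : E →ₗ[ℝ] E} (hP : IsBandProjection P) {x y : E}
    (hx : 0 ≤ x) (hy : 0 ≤ y) : P x ⊓ (y - P y) = 0 := by
  have mono : ∀ a b, a ≤ b → P a ≤ P b ∧ a - P a ≤ b - P b := by
    intro a b hab
    have h := hP.2 (b - a) (sub_nonneg.2 hab)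
    rw [map_sub] at h
    refine ⟨sub_nonneg.1 h.1, ?_⟩
    rw [← sub_nonneg]
    exact le_of_le_of_eq (sub_nonneg.2 h.2) (by abel)
  set z := P x ⊓ (y - P y) with hz
  have hz0 : 0 ≤ z := le_inf (hP.2 x hx).1 (sub_nonneg.2 (hP.2 y hy).2)
  have h1 : P z ≤ 0 := by
    have := (mono z (y - P y) inf_le_right).1
    rwa [map_sub, hP.1, sub_self] at this
  have h2 : z - P z ≤ 0 := by
    have := (mono z (P x) inf_le_left).2
    rwa [hP.1, sub_self] at this
  exact le_antisymm ((sub_nonpos.1 h2).trans h1) hz0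

/-- `Pe · Qe = PQe` for band projections `P` and `Q`. -/
theorem eMul_bandProjection {e : E} (he : 0 ≤ e) {P Q : E →ₗ[ℝ] E} (hP : IsBandProjection P)
    (hQ : IsBandProjection Q) : eMul e (P e) (Q e) = P (Q e) := by
  have hb : ∀ x, 0 ≤ x → x ≤ e → x ∈ bounded e := fun x h0 h1 =>
    ⟨1, zero_le_one, by rwa [abs_of_nonneg h0, one_smul]⟩
  have q := hQ.2 e he
  have p := hP.2 e he
  have pq := hP.2 (Q e) q.1
  have b1 := hb _ p.1 p.2
  have b2 := hb _ q.1 q.2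
  have b3 := hb _ pq.1 (pq.2.trans q.2)
  have h1 : eMul e (P e) (Q e - P (Q e)) = 0 :=
    eMul_eq_zero_of_disjoint he b1 (bounded_sub b2 b3) (hP.disjoint he q.1)
  have h2 : eMul e (e - P e) (P (Q e)) = 0 := by
    rw [eMul_comm]
    exact eMul_eq_zero_of_disjoint he b3 (bounded_sub (unit_bounded he) b1) (hP.disjoint q.1 he)
  rw [eMul_sub_right he b2 b3 b1, sub_eq_zero] at h1
  rw [eMul_sub_left he (unit_bounded he) b1 b3, sub_eq_zero, eMul_comm, eMul_unit he b3] at h2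
  rw [h1, ← h2]

/-- Multiplication is order continuous in each variable. -/
theorem eMul_orderTendsto {e : E} (he : 0 ≤ e) {x : ℕ → E} {l g : E} (hx : ∀ n, x n ∈ bounded e)
    (hl : l ∈ bounded e) (hg : g ∈ bounded e) (h : OrderTendsto x l) :
    OrderTendsto (fun n => eMul e (x n) g) (eMul e l g) := by
  obtain ⟨u, hu, hu0, hxu⟩ := h
  obtain ⟨k, hk, hgk⟩ := id hg
  have hk1 : 0 < k + 1 := by linarith
  refine ⟨fun n => (k + 1) • u n, fun m n hmn => smul_le_smul_of_nonneg_left (hu hmn) hk1.le,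
    ⟨?_, fun b hb => ?_⟩, ?_⟩
  · rintro _ ⟨n, rfl⟩
    exact smul_nonneg hk1.le (hu0.1 ⟨n, rfl⟩)
  · have h1 : (k + 1)⁻¹ • b ≤ 0 := by
      refine hu0.2 ?_
      rintro _ ⟨n, rfl⟩
      have := smul_le_smul_of_nonneg_left (hb ⟨n, rfl⟩) (inv_nonneg.2 hk1.le)
      simpa [inv_smul_smul₀ hk1.ne'] using this
    have h2 := smul_le_smul_of_nonneg_left h1 hk1.le
    rwa [smul_inv_smul₀ hk1.ne', smul_zero] at h2
  · filter_upwards [hxu] with n hn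
    rw [← eMul_sub_left he (hx n) hl hg]
    refine (abs_eMul_le he (bounded_sub (hx n) hl) hk hgk).trans ?_
    calc k • |x n - l| ≤ (k + 1) • |x n - l| :=
          smul_le_smul_of_nonneg_right (by linarith) (abs_nonneg _)
      _ ≤ (k + 1) • u n := smul_le_smul_of_nonneg_left hn hk1.le

end Multiplication

end RieszErgodic

set_option linter.unusedSectionVars false

namespace RieszErgodic

variable {E : Type*} [ConditionallyCompleteLattice E] [AddCommGroup E] [IsOrderedAddMonoid E]
  [Module ℝ E] [IsOrderedModule ℝ E]

/-! ### Projections onto principal bands. -/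

section BandProjections

/-! For `S f = f` the Cesàro means are constantly `f`, so ergodicity says exactly that `T` fixes
every `S`-invariant element (`isErgodic_iff`).

If this holds, a Birkhoff theorem on `E_e` (`orderTendsto_cesaro`) gives convergence of the means of
`f` to `T f`. Multiplying by `g` and applying the order continuous `T` yields the limit `T (T f ·
g)`, which is `T f · T g` because `T` is a module map over its range (`map_eMul_of_map_eq`).
Conversely, for invariant bounded `f` the sequence in the mixing condition is eventually constant,
so `T (f · g) = T f · T g` for all bounded `g`. Then `T ((f - T f)²) = 0`, and strict positivity
gives `f = T f` (`map_eq_of_eMul`); unbounded `f` are reached by truncation (`map_eq_of_bounded`).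

The Birkhoff theorem rests on three facts. Freudenthal's theorem extends `T S = T` from components
of `e` to `E_e` (`condExp_map_eq`). The limit superior `l` of the means satisfies `l ≤ S l`, hence
`S l = l` by strict positivity (`map_limsupCesaro`). The maximal ergodic theorem gives `T l ≤ T f`
(`map_limsupCesaro_le`). Under ergodicity `l = T l ≤ T f`, and the same bound for `-f` squeezes the
means. -/

theorem nonpos_of_forall_le_smul {e x : E} (he : 0 ≤ e) (h : ∀ ε : ℝ, 0 < ε → x ≤ ε • e) :
    x ≤ 0 := by
  refine le_zero_of_nat_smul_le (y := e) fun n => ?_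
  rcases n.eq_zero_or_pos with rfl | hn
  · simpa using he
  · have hn' : (0 : ℝ) < n := by exact_mod_cast hn
    have := smul_le_smul_of_nonneg_left (h (n : ℝ)⁻¹ (inv_pos.2 hn')) hn'.le
    rwa [smul_inv_smul₀ hn'.ne'] at this

theorem add_inf_le {y z w : E} (hy : 0 ≤ y) (hz : 0 ≤ z) (hw : 0 ≤ w) : (y + z) ⊓ w ≤ y ⊓ w + z ⊓ w := by
  rw [inf_add]
  refine le_inf ?_ (inf_le_right.trans (le_add_of_nonneg_right (le_inf hz hw)))
  rw [add_inf]
  exact inf_le_inf le_rfl (le_add_of_nonneg_left hy)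

/-- The component of `y ≥ 0` in the band generated by `x ≥ 0`. -/
noncomputable def bandPart (x y : E) : E := ⨆ s : ℝ, y ⊓ |s| • x

theorem bandPart_le {x y b : E} (h : ∀ s : ℝ, y ⊓ |s| • x ≤ b) : bandPart x y ≤ b :=
  ciSup_le h

theorem inf_le_bandPart (x y : E) (s : ℝ) : y ⊓ |s| • x ≤ bandPart x y :=
  le_ciSup (f := fun s : ℝ => y ⊓ |s| • x) ⟨y, by rintro _ ⟨s, rfl⟩; exact inf_le_left⟩ s

theorem bandPart_le_self (x y : E) : bandPart x y ≤ y := bandPart_le fun _ => inf_le_left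

theorem bandPart_nonneg {x y : E} (hy : 0 ≤ y) : 0 ≤ bandPart x y := by
  simpa [hy] using inf_le_bandPart x y 0

theorem bandPart_add {x y z : E} (hx : 0 ≤ x) (hy : 0 ≤ y) (hz : 0 ≤ z) :
    bandPart x (y + z) = bandPart x y + bandPart x z := by
  refine le_antisymm (bandPart_le fun s => ?_) ?_
  · exact (add_inf_le hy hz (smul_nonneg (abs_nonneg s) hx)).trans
      (add_le_add (inf_le_bandPart x y s) (inf_le_bandPart x z s))
  -- The two suprema are removed one at a time; multiples `|s|` and `|t|` of `x` are absorbed by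
  -- `|s| + |t|`.
  · rw [← le_sub_iff_add_le]
    refine bandPart_le fun s => ?_
    rw [le_sub_comm]
    refine bandPart_le fun t => ?_
    rw [le_sub_iff_add_le]
    refine le_trans (le_inf ?_ ?_) (inf_le_bandPart x (y + z) (|s| + |t|))
    · rw [add_comm y]; exact add_le_add inf_le_left inf_le_left
    · rw [abs_of_nonneg (a := |s| + |t|) (by positivity), add_smul, add_comm (|s| • x)]
      exact add_le_add inf_le_right inf_le_right

theorem bandPart_smul {x y : E} {t : ℝ} (ht : 0 ≤ t) :
    bandPart x (t • y) = t • bandPart x y := by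
  have key : ∀ (t : ℝ) (y : E), 0 < t → bandPart x (t • y) ≤ t • bandPart x y := by
    intro t y ht
    refine bandPart_le fun s => ?_
    have h : t⁻¹ • (t • y ⊓ |s| • x) ≤ y ⊓ |t⁻¹ * s| • x := by
      refine le_inf ?_ ?_
      · exact (smul_le_smul_of_nonneg_left inf_le_left (inv_nonneg.2 ht.le)).trans_eq
          (inv_smul_smul₀ ht.ne' y)
      · refine (smul_le_smul_of_nonneg_left inf_le_right (inv_nonneg.2 ht.le)).trans_eq ?_
        rw [abs_mul, abs_of_nonneg (inv_nonneg.2 ht.le), mul_smul]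
    have h' := smul_le_smul_of_nonneg_left (h.trans (inf_le_bandPart x y _)) ht.le
    rwa [smul_inv_smul₀ ht.ne'] at h'
  rcases ht.eq_or_lt with rfl | ht
  · rw [zero_smul, zero_smul]
    exact le_antisymm (bandPart_le_self x 0) (bandPart_nonneg le_rfl)
  · refine le_antisymm (key t y ht) ?_
    have h := smul_le_smul_of_nonneg_left (key t⁻¹ (t • y) (inv_pos.2 ht)) ht.le
    rwa [inv_smul_smul₀ ht.ne', smul_inv_smul₀ ht.ne'] at h

/-- Additivity on the positive cone makes the difference independent of how an element is written as
a difference of positive ones; linearity of `bandProjection` follows from this. -/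
theorem bandPart_posPart_sub_negPart {x a b : E} (hx : 0 ≤ x) (ha : 0 ≤ a) (hb : 0 ≤ b) :
    bandPart x (a - b)⁺ - bandPart x (a - b)⁻ = bandPart x a - bandPart x b := by
  rw [sub_eq_sub_iff_add_eq_add, ← bandPart_add hx (posPart_nonneg _) hb,
    ← bandPart_add hx ha (negPart_nonneg _)]
  congr 1
  have := posPart_sub_negPart (a - b)
  rw [sub_eq_sub_iff_add_eq_add] at this
  exact this

/-- The projection onto the band generated by `x ≥ 0`. -/
noncomputable def bandProjection (x : E) (hx : 0 ≤ x) : E →ₗ[ℝ] E where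
  toFun y := bandPart x y⁺ - bandPart x y⁻
  map_add' y z := by
    have h : y + z = (y⁺ + z⁺) - (y⁻ + z⁻) := by
      conv_lhs => rw [← posPart_sub_negPart y, ← posPart_sub_negPart z]
      abel
    conv_lhs => rw [h]
    rw [bandPart_posPart_sub_negPart hx (add_nonneg (posPart_nonneg _) (posPart_nonneg _))
      (add_nonneg (negPart_nonneg _) (negPart_nonneg _)),
      bandPart_add hx (posPart_nonneg _) (posPart_nonneg _),
      bandPart_add hx (negPart_nonneg _) (negPart_nonneg _)]
    abel
  map_smul' t y := by
    have hp := posPart_nonneg y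
    have hn := negPart_nonneg y
    rcases le_total 0 t with ht | ht
    · have h : t • y = t • y⁺ - t • y⁻ := by rw [← smul_sub, posPart_sub_negPart]
      conv_lhs => rw [h]
      rw [bandPart_posPart_sub_negPart hx (smul_nonneg ht hp) (smul_nonneg ht hn),
        bandPart_smul ht, bandPart_smul ht, ← smul_sub, RingHom.id_apply]
    · have ht' : 0 ≤ -t := neg_nonneg.2 ht
      have h : t • y = (-t) • y⁻ - (-t) • y⁺ := by
        conv_lhs => rw [← posPart_sub_negPart y]
        module
      conv_lhs => rw [h]
      rw [bandPart_posPart_sub_negPart hx (smul_nonneg ht' hn) (smul_nonneg ht' hp),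
        bandPart_smul ht', bandPart_smul ht', RingHom.id_apply]
      module

theorem bandProjection_of_nonneg {x y : E} (hx : 0 ≤ x) (hy : 0 ≤ y) :
    bandProjection x hx y = bandPart x y := by
  have h := bandPart_posPart_sub_negPart hx hy le_rfl
  rw [sub_zero] at h
  refine h.trans (sub_eq_self.2 (le_antisymm (bandPart_le_self x 0) (bandPart_nonneg le_rfl)))

theorem isBandProjection_bandProjection {x : E} (hx : 0 ≤ x) :
    IsBandProjection (bandProjection x hx) := by
  have idem : ∀ y, 0 ≤ y →
      bandProjection x hx (bandProjection x hx y) = bandProjection x hx y := by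
    intro y hy
    rw [bandProjection_of_nonneg hx hy, bandProjection_of_nonneg hx (bandPart_nonneg hy)]
    refine le_antisymm (bandPart_le_self _ _) (bandPart_le fun s => ?_)
    exact (le_inf (inf_le_bandPart x y s) inf_le_right).trans (inf_le_bandPart _ _ s)
  refine ⟨fun y => ?_, fun y hy => ?_⟩
  · rw [← posPart_sub_negPart y, map_sub, map_sub, idem _ (posPart_nonneg y),
      idem _ (negPart_nonneg y)]
  · rw [bandProjection_of_nonneg hx hy]
    exact ⟨bandPart_nonneg hy, bandPart_le_self x y⟩

end BandProjections

/-! ### Approximation by components of the unit. -/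

section Freudenthal

/-- The slice of `f` between the levels `i δ e` and `(i + 1) δ e`. -/
def slice (e f : E) (δ : ℝ) (i : ℕ) : E := δ • e ⊓ (f - ((i : ℝ) * δ) • e)⁺

theorem sum_slice {e f : E} {δ : ℝ} (he : 0 ≤ e) (hf : 0 ≤ f) (hδ : 0 ≤ δ) (N : ℕ) :
    ∑ i ∈ Finset.range N, slice e f δ i = f ⊓ ((N : ℝ) * δ) • e := by
  induction N with
  | zero => simp [hf]
  | succ N ih =>
    rw [Finset.sum_range_succ, ih, slice]
    set a := ((N : ℝ) * δ) • e
    have h1 : (((N + 1 : ℕ) : ℝ) * δ) • e = a + δ • e := by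
      simp only [a]; push_cast; module
    have h2 : f ⊓ a + (f - a)⁺ = f := by
      have h3 : (f - a)⁺ = f ⊔ a - a := by rw [posPart_def, sup_sub, sub_self]
      rw [h3, ← add_sub_assoc, inf_add_sup, add_sub_cancel_right]
    rw [h1, add_inf, h2, inf_add]
    refine le_antisymm (le_inf inf_le_right (inf_le_left.trans inf_le_right))
      (le_inf (le_inf ?_ inf_le_right) inf_le_left)
    exact inf_le_left.trans (le_add_of_nonneg_right (smul_nonneg hδ he))

/-- With its companion `smul_bandPart_le_slice`, this traps each slice between `δ` times the
components of `e` at two consecutive levels, so that summing approximates `f` within `δ • e`. -/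
theorem slice_le_smul_bandPart {e f : E} {δ : ℝ} (hδ : 0 < δ) (i : ℕ) :
    slice e f δ i ≤ δ • bandPart (f - ((i : ℝ) * δ) • e)⁺ e := by
  have h : δ⁻¹ • slice e f δ i ≤ e ⊓ |δ⁻¹| • (f - ((i : ℝ) * δ) • e)⁺ := by
    refine le_inf ?_ ?_
    · exact (smul_le_smul_of_nonneg_left inf_le_left (inv_nonneg.2 hδ.le)).trans_eq
          (inv_smul_smul₀ hδ.ne' e)
    · rw [abs_of_nonneg (inv_nonneg.2 hδ.le)]
      exact smul_le_smul_of_nonneg_left inf_le_right (inv_nonneg.2 hδ.le)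
  have h' := smul_le_smul_of_nonneg_left (h.trans (inf_le_bandPart _ _ _)) hδ.le
  rwa [smul_inv_smul₀ hδ.ne'] at h'

theorem le_of_le_add_of_disjoint {v w z : E} (hz : 0 ≤ z) (hvw : v ⊓ w = 0) (h : v ≤ z + w) :
    v ≤ z := by
  have hv : 0 ≤ v := hvw.ge.trans inf_le_left
  have h1 : v ≤ z + w ⊓ v := by
    rw [add_inf]
    exact le_inf h (le_add_of_nonneg_left hz)
  rwa [inf_comm, hvw, add_zero] at h1

theorem smul_inf_smul_eq_zero' {a b : E} (h : a ⊓ b = 0) {k l : ℝ} (hk : 0 ≤ k) (hl : 0 ≤ l) :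
    k • a ⊓ l • b = 0 := by
  have ha : 0 ≤ a := h.ge.trans inf_le_left
  have hb : 0 ≤ b := h.ge.trans inf_le_right
  refine le_antisymm ?_ (le_inf (smul_nonneg hk ha) (smul_nonneg hl hb))
  rw [← smul_inf_smul_eq_zero h (max k l) (hk.trans (le_max_left k l))]
  exact inf_le_inf (smul_le_smul_of_nonneg_right (le_max_left k l) ha)
    (smul_le_smul_of_nonneg_right (le_max_right k l) hb)

theorem smul_bandPart_le_slice {e f : E} {δ : ℝ} (he : 0 ≤ e) (hδ : 0 < δ) (i : ℕ) :
    δ • bandPart (f - (((i + 1 : ℕ) : ℝ) * δ) • e)⁺ e ≤ slice e f δ i := by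
  refine le_inf (smul_le_smul_of_nonneg_left (bandPart_le_self _ _) hδ.le) ?_
  suffices h : bandPart (f - (((i + 1 : ℕ) : ℝ) * δ) • e)⁺ e ≤
      δ⁻¹ • (f - ((i : ℝ) * δ) • e)⁺ by
    have h' := smul_le_smul_of_nonneg_left h hδ.le
    rwa [smul_inv_smul₀ hδ.ne'] at h'
  refine bandPart_le fun s => ?_
  set g := f - (((i + 1 : ℕ) : ℝ) * δ) • e with hg
  have hg' : f - ((i : ℝ) * δ) • e = g + δ • e := by
    rw [hg]; push_cast; module
  rw [hg']
  have hg0 : g⁺ ⊓ g⁻ = 0 := posPart_inf_negPart_eq_zero g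
  have hd : (e ⊓ |s| • g⁺) ⊓ δ⁻¹ • g⁻ = 0 := by
    have h := smul_inf_smul_eq_zero' hg0 (abs_nonneg s) (inv_nonneg.2 hδ.le)
    rw [inf_assoc, h, inf_eq_right]
    exact he
  -- The multiple of `g⁻` is disjoint from the left side, so it may be added to the bound for free;
  -- with it the bound dominates `e`.
  refine le_of_le_add_of_disjoint (smul_nonneg (inv_nonneg.2 hδ.le) (posPart_nonneg _)) hd ?_
  rw [← smul_add]
  have h1 : δ • e ≤ (g + δ • e)⁺ + g⁻ := by
    calc δ • e = (g + δ • e) - g := by abel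
      _ ≤ (g + δ • e)⁺ + g⁻ := by
        rw [sub_eq_add_neg]
        exact add_le_add (le_posPart _) (neg_le_negPart g)
  have h2 := smul_le_smul_of_nonneg_left h1 (inv_nonneg.2 hδ.le)
  rw [inv_smul_smul₀ hδ.ne'] at h2
  exact inf_le_left.trans h2

/-- Freudenthal's spectral theorem: `e`-bounded elements are uniform limits of linear combinations
of components of `e`. -/
theorem exists_mem_span_bandProjection {e f : E} (he : 0 ≤ e) (hf : f ∈ bounded e) (hf0 : 0 ≤ f)
    {δ : ℝ} (hδ : 0 < δ) :
    ∃ v ∈ Submodule.span ℝ {x : E | ∃ P : E →ₗ[ℝ] E, IsBandProjection P ∧ P e = x},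
      |f - v| ≤ δ • e := by
  obtain ⟨k, hk, hfk⟩ := hf
  obtain ⟨N, hN⟩ := exists_nat_ge (k / δ)
  have hfN : ∀ M : ℕ, N ≤ M → f ⊓ ((M : ℝ) * δ) • e = f := by
    intro M hM
    refine inf_eq_left.2 ((le_abs_self f).trans (hfk.trans (smul_le_smul_of_nonneg_right ?_ he)))
    have : (N : ℝ) ≤ M := by exact_mod_cast hM
    exact (div_le_iff₀ hδ).1 (hN.trans this)
  set q : ℕ → E := fun i => δ • bandPart (f - ((i : ℝ) * δ) • e)⁺ e with hq
  refine ⟨∑ i ∈ Finset.range (N + 1), q i, Submodule.sum_mem _ fun i _ => ?_, ?_⟩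
  · refine Submodule.smul_mem _ _ (Submodule.subset_span
      ⟨_, isBandProjection_bandProjection (posPart_nonneg (f - ((i : ℝ) * δ) • e)), ?_⟩)
    exact bandProjection_of_nonneg _ he
  · have h1 : f ≤ ∑ i ∈ Finset.range (N + 1), q i := by
      rw [← hfN (N + 1) (Nat.le_succ N), ← sum_slice he hf0 hδ.le]
      exact Finset.sum_le_sum fun i _ => slice_le_smul_bandPart hδ i
    have h2 : ∑ i ∈ Finset.range (N + 1), q i ≤ f + δ • e := by
      -- The term `q 0` costs at most `δ • e`; each `q (i + 1)` lies below slice `i`.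
      rw [Finset.sum_range_succ', ← hfN N le_rfl, ← sum_slice he hf0 hδ.le]
      exact add_le_add (Finset.sum_le_sum fun i _ => smul_bandPart_le_slice he hδ i)
        (smul_le_smul_of_nonneg_left (bandPart_le_self _ _) hδ.le)
    rw [abs_sub_comm]
    refine abs_le'.2 ⟨sub_le_iff_le_add'.2 h2, ?_⟩
    rw [neg_sub]
    exact (sub_nonpos.2 h1).trans (smul_nonneg hδ.le he)

end Freudenthal

/-! ### Positive and strictly positive operators. -/

section PositiveOperators

theorem eq_of_abs_sub_nonpos {x y : E} (h : |x - y| ≤ 0) : x = y := by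
  have h' := abs_le'.1 h
  exact le_antisymm (sub_nonpos.1 h'.1) (by rw [← sub_nonpos, ← neg_sub]; exact h'.2)

variable {A T S : E →ₗ[ℝ] E} {e : E}

theorem IsPositive.mono (hA : IsPositive A) {x y : E} (h : x ≤ y) : A x ≤ A y := by
  have := hA (y - x) (sub_nonneg.2 h)
  rwa [map_sub, sub_nonneg] at this

theorem IsPositive.abs_map_le (hA : IsPositive A) (x : E) : |A x| ≤ A |x| := by
  refine abs_le'.2 ⟨hA.mono (le_abs_self x), ?_⟩
  rw [← map_neg]
  exact hA.mono (neg_le_abs x)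

theorem IsPositive.map_bounded (hA : IsPositive A) (hAe : A e = e) {f : E} (hf : f ∈ bounded e) :
    A f ∈ bounded e := by
  obtain ⟨k, hk, h⟩ := hf
  refine ⟨k, hk, (hA.abs_map_le f).trans ((hA.mono h).trans_eq ?_)⟩
  rw [map_smul, hAe]

/-- This is the way strict positivity turns an inequality such as `l ≤ S l` into an equality. -/
theorem IsStrictlyPositive.eq_of_le (hT : IsStrictlyPositive T) {x y : E} (h : x ≤ y)
    (h' : T y ≤ T x) : x = y := by
  have h0 := (hT.2 (y - x) (sub_nonneg.2 h)).1
    (by rw [map_sub, le_antisymm h' (hT.1.mono h), sub_self])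
  exact (sub_eq_zero.1 h0).symm

theorem posPart_bounded {f : E} (hf : f ∈ bounded e) : f⁺ ∈ bounded e :=
  bounded_of_abs_le hf <| by
    rw [abs_of_nonneg (posPart_nonneg f), ← posPart_add_negPart f]
    exact le_add_of_nonneg_right (negPart_nonneg f)

theorem negPart_bounded {f : E} (hf : f ∈ bounded e) : f⁻ ∈ bounded e :=
  bounded_of_abs_le hf <| by
    rw [abs_of_nonneg (negPart_nonneg f), ← posPart_add_negPart f]
    exact le_add_of_nonneg_left (posPart_nonneg f)

theorem IsPositive.pow (hA : IsPositive A) (n : ℕ) : IsPositive (A ^ n) := by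
  induction n with
  | zero => intro x hx; simpa using hx
  | succ n ih => intro x hx; rw [pow_succ']; exact hA _ (ih x hx)

theorem pow_apply_of_eq {f : E} (h : A f = f) (n : ℕ) : (A ^ n) f = f := by
  induction n with
  | zero => simp
  | succ n ih => rw [pow_succ']; exact (congrArg A ih).trans h

end PositiveOperators

/-! ### Invariance of the conditional expectation under `S`. -/

namespace IsCondExpPreservingSystem

variable {T S : E →ₗ[ℝ] E} {e : E}

theorem S_positive (h : IsCondExpPreservingSystem T S e) : IsPositive S := by
  intro x hx
  have := h.S_latticeHom x 0
  rw [sup_eq_left.2 hx, map_zero] at this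
  rw [this]
  exact le_sup_right

/-- The identity holds on the span of the components of `e`, which approximates `f` uniformly, and
`S` and `T` preserve bounds by multiples of `e`. -/
theorem condExp_map_eq (h : IsCondExpPreservingSystem T S e) {f : E} (hf : f ∈ bounded e) :
    T (S f) = T f := by
  have he := h.weakOrderUnit.1
  have hTpos := h.condExp.positive
  have key : ∀ f ∈ bounded e, 0 ≤ f → T (S f) = T f := by
    intro f hf hf0
    -- One `δ` comes from `T (S (f - v))`, the other from `T (f - v)`.
    have approx : ∀ δ : ℝ, 0 < δ → |T (S f) - T f| ≤ (2 * δ) • e := by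
      intro δ hδ
      obtain ⟨v, hv, hfv⟩ := exists_mem_span_bandProjection he hf hf0 hδ
      have hTv : T (S v) = T v := by
        clear hfv
        induction hv using Submodule.span_induction with
        | mem x hx => obtain ⟨P, hP, rfl⟩ := hx; exact h.preserving P hP
        | zero => simp
        | add x y _ _ hx hy => rw [map_add, map_add, map_add, hx, hy]
        | smul t x _ hx => rw [map_smul, map_smul, map_smul, hx]
      have h1 : |T (S (f - v))| ≤ δ • e := by
        refine (hTpos.abs_map_le _).trans ((hTpos.mono
          ((h.S_positive.abs_map_le _).trans (h.S_positive.mono hfv))).trans_eq ?_)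
        rw [map_smul, map_smul, h.S_unit, h.T_unit]
      have h2 : |T (f - v)| ≤ δ • e := by
        refine (hTpos.abs_map_le _).trans ((hTpos.mono hfv).trans_eq ?_)
        rw [map_smul, h.T_unit]
      have h3 : T (S f) - T f = T (S (f - v)) + -T (f - v) := by
        simp only [map_sub, hTv]; abel
      rw [h3, two_mul, add_smul]
      refine (abs_add_le _ _).trans (add_le_add h1 ?_)
      rwa [abs_neg]
    have h0 : |T (S f) - T f| ≤ 0 := nonpos_of_forall_le_smul he fun ε hε => by
      simpa [mul_div_cancel₀] using approx (ε / 2) (by positivity)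
    exact eq_of_abs_sub_nonpos h0
  rw [← posPart_sub_negPart f, map_sub, map_sub, map_sub,
    key _ (posPart_bounded hf) (posPart_nonneg f), key _ (negPart_bounded hf) (negPart_nonneg f)]

end IsCondExpPreservingSystem

/-! ### Squares and the averaging property of `T`. -/

section Averaging

variable {T : E →ₗ[ℝ] E} {e : E}

/-- The Kadison–Schwarz inequality. -/
theorem eSq_map_le (he : 0 ≤ e) (hT : IsPositive T) (hTe : T e = e) {f : E} (hf : f ∈ bounded e) :
    eSq e (T f) ≤ T (eSq e f) := by
  refine eSq_le he (hT.map_bounded hTe hf) fun c => ?_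
  have h := hT.mono (le_eSq he hf c)
  rwa [map_sub, map_smul, map_smul, hTe] at h

/-- Kadison–Schwarz gives `f² ≤ T (f²)`; both sides have the same image under the projection `T`, so
strict positivity forces equality. -/
theorem map_eSq_of_map_eq (he : 0 ≤ e) (hT : IsStrictlyPositive T) (hTe : T e = e)
    (hTT : ∀ x, T (T x) = T x) {f : E} (hf : f ∈ bounded e) (hTf : T f = f) :
    T (eSq e f) = eSq e f := by
  have h := eSq_map_le he hT.1 hTe hf
  rw [hTf] at h
  exact (hT.eq_of_le h (hTT _).le).symm

theorem eSq_smul_add (he : 0 ≤ e) {f g : E} (hf : f ∈ bounded e) (hg : g ∈ bounded e) (t : ℝ) :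
    eSq e (f + t • g) = eSq e f + (2 * t) • eMul e f g + t ^ 2 • eSq e g := by
  have htg := bounded_smul t hg
  have hs := bounded_add hf htg
  rw [← eMul_self he hs, ← eMul_self he hf, ← eMul_self he hg, eMul_add_left he hf htg hs,
    eMul_smul_left he hg hs, eMul_comm e f (f + _), eMul_comm e g (f + _),
    eMul_add_left he hf htg hf, eMul_add_left he hf htg hg, eMul_smul_left he hg hf,
    eMul_smul_left he hg hg, eMul_comm e g f]
  module

/-- A conditional expectation is a module map over its range. -/
theorem map_eMul_of_map_eq (he : 0 ≤ e) (hT : IsStrictlyPositive T) (hTe : T e = e)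
    (hTT : ∀ x, T (T x) = T x) {f g : E} (hf : f ∈ bounded e) (hg : g ∈ bounded e)
    (hTg : T g = g) : T (eMul e f g) = eMul e (T f) g := by
  have hTf := hT.1.map_bounded hTe hf
  set d := T (eMul e f g) - eMul e (T f) g with hd
  set b := T (eSq e f) - eSq e (T f) with hb
  -- Kadison–Schwarz for `f + t g`: the `t²` terms cancel since `T` fixes `g²`. An affine function
  -- of `t` that stays nonnegative has zero slope, whence `d = 0`.
  have key : ∀ t : ℝ, 0 ≤ b + (2 * t) • d := by
    intro t
    have h := eSq_map_le he hT.1 hTe (bounded_add hf (bounded_smul t hg))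
    rw [map_add, map_smul, hTg, eSq_smul_add he hf hg, eSq_smul_add he hTf hg, map_add, map_add,
      map_smul, map_smul, map_eSq_of_map_eq he hT hTe hTT hg hTg, ← sub_nonneg] at h
    refine h.trans_eq ?_
    rw [hd, hb]
    module
  have h1 : d ≤ 0 := le_zero_of_nat_smul_le (y := b) fun n => by
    have h := key (-(n / 2))
    rw [← sub_nonneg]
    refine h.trans_eq ?_
    module
  have h2 : -d ≤ 0 := le_zero_of_nat_smul_le (y := b) fun n => by
    have h := key (n / 2)
    rw [← sub_nonneg]
    refine h.trans_eq ?_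
    module
  exact sub_eq_zero.1 (le_antisymm h1 (neg_nonpos.1 h2))

theorem eq_zero_of_eSq_eq_zero (he : 0 ≤ e) {f : E} (hf : f ∈ bounded e) (h : eSq e f = 0) :
    f = 0 := by
  have key : ∀ g ∈ bounded e, eSq e g = 0 → g ≤ 0 := by
    intro g hg h
    refine nonpos_of_forall_le_smul he fun ε hε => ?_
    -- With `c = 2ε` the inequality `2c g ≤ c² e` reads `4ε g ≤ 4ε² e`, that is `g ≤ ε e`.
    have h1 := le_eSq he hg (2 * ε)
    rw [h, sub_nonpos] at h1
    have h2 := smul_le_smul_of_nonneg_left h1 (by positivity : (0 : ℝ) ≤ (4 * ε)⁻¹)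
    rw [smul_smul, smul_smul] at h2
    convert h2 using 1
    · rw [show (4 * ε)⁻¹ * (2 * (2 * ε)) = 1 by field_simp; norm_num, one_smul]
    · congr 1; field_simp; norm_num
  exact le_antisymm (key f hf h)
    (neg_nonpos.1 (key (-f) (bounded_neg hf) (by rw [eSq_neg, h])))

end Averaging

/-! ### Order limits and truncation. -/

section OrderConvergence

theorem OrderTendsto.unique {x : ℕ → E} {l m : E} (hl : OrderTendsto x l) (hm : OrderTendsto x m) :
    l = m := by
  obtain ⟨u, hu, hu0, hxu⟩ := hl
  obtain ⟨v, hv, hv0, hxv⟩ := hm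
  have hn : ∀ᶠ n in atTop, |l - m| ≤ u n + v n := by
    filter_upwards [hxu, hxv] with n h1 h2
    calc |l - m| = |-(x n - l) + (x n - m)| := by congr 1; abel
      _ ≤ |x n - l| + |x n - m| := by
        rw [← abs_neg (x n - l)]; exact abs_add_le _ _
      _ ≤ _ := add_le_add h1 h2
  -- Monotonicity decouples the two indices, so the infima can be taken one after the other.
  have hall : ∀ i j, |l - m| ≤ u i + v j := by
    intro i j
    obtain ⟨n, hn, hni⟩ := (hn.and (eventually_ge_atTop (max i j))).exists
    exact hn.trans (add_le_add (hu ((le_max_left i j).trans hni))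
      (hv ((le_max_right i j).trans hni)))
  have h0 : |l - m| ≤ 0 := by
    refine hv0.2 ?_
    rintro _ ⟨j, rfl⟩
    rw [← sub_nonpos]
    refine hu0.2 ?_
    rintro _ ⟨i, rfl⟩
    exact sub_le_iff_le_add.2 (hall i j)
  exact eq_of_abs_sub_nonpos h0

theorem orderTendsto_of_eventuallyEq {x : ℕ → E} {l : E} (h : ∀ᶠ n in atTop, x n = l) :
    OrderTendsto x l := by
  refine ⟨fun _ => 0, antitone_const, by simp, ?_⟩
  filter_upwards [h] with n hn
  simp [hn]

theorem OrderTendsto.map {A : E →ₗ[ℝ] E} (hA : IsPositive A) (hAc : IsOrderContinuous A)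
    {x : ℕ → E} {l : E} (h : OrderTendsto x l) : OrderTendsto (fun n => A (x n)) (A l) := by
  obtain ⟨u, hu, hu0, hxu⟩ := h
  refine ⟨fun n => A (u n), fun m n hmn => hA.mono (hu hmn), ?_, ?_⟩
  · have := hAc (Set.range u) (Set.range_nonempty u) (directedOn_range.2 hu.directed_ge) hu0
    rwa [← Set.range_comp] at this
  · filter_upwards [hxu] with n hn
    rw [← map_sub]
    exact (hA.abs_map_le _).trans (hA.mono hn)

/-- An element is determined by its truncations at multiples of a weak order unit. -/
theorem le_of_forall_inf_smul_le {e f y : E} (he : IsWeakOrderUnit e)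
    (h : ∀ n : ℕ, f ⊓ (n : ℝ) • e ≤ y) : f ≤ y := by
  have hb : BddAbove (Set.range fun n : ℕ => f ⊓ (n : ℝ) • e) :=
    ⟨f, by rintro _ ⟨n, rfl⟩; exact inf_le_left⟩
  set x := ⨆ n : ℕ, f ⊓ (n : ℝ) • e with hx
  have hxf : x ≤ f := ciSup_le fun n => inf_le_left
  have hz : e ⊓ (f - x) = 0 := by
    refine le_antisymm ?_ (le_inf he.1 (sub_nonneg.2 hxf))
    set z := e ⊓ (f - x)
    -- Adding `z` to the `n`-th truncation stays below the `(n + 1)`-st, hence below `x`.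
    have : x ≤ x - z := by
      refine ciSup_le fun n => ?_
      rw [le_sub_iff_add_le]
      refine le_trans (le_inf ?_ ?_) (le_ciSup hb (n + 1))
      · calc f ⊓ (n : ℝ) • e + z ≤ x + (f - x) := add_le_add (le_ciSup hb n) inf_le_right
          _ = f := by abel
      · push_cast
        rw [add_smul, one_smul]
        exact add_le_add inf_le_right inf_le_left
    simpa using this
  have := he.2 (f - x) (sub_nonneg.2 hxf) hz
  rw [sub_eq_zero] at this
  rw [this]
  exact ciSup_le h

end OrderConvergence

/-! ### Cesàro means. -/

section Cesaro

variable {S : E →ₗ[ℝ] E} {e : E}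

theorem cesaro_of_map_eq {f : E} (hf : S f = f) {n : ℕ} (hn : n ≠ 0) : cesaro S f n = f := by
  have hn' : (n : ℝ) ≠ 0 := by exact_mod_cast hn
  simp only [cesaro, pow_apply_of_eq hf, Finset.sum_const, Finset.card_range]
  rw [← Nat.cast_smul_eq_nsmul ℝ, inv_smul_smul₀ hn']

theorem cesaro_add (f g : E) (n : ℕ) : cesaro S (f + g) n = cesaro S f n + cesaro S g n := by
  simp only [cesaro, map_add, Finset.sum_add_distrib, smul_add]

theorem cesaro_neg (f : E) (n : ℕ) : cesaro S (-f) n = -cesaro S f n := by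
  simp only [cesaro, map_neg, Finset.sum_neg_distrib, smul_neg]

theorem cesaro_mono (hS : IsPositive S) {f g : E} (h : f ≤ g) (n : ℕ) :
    cesaro S f n ≤ cesaro S g n :=
  smul_le_smul_of_nonneg_left (Finset.sum_le_sum fun k _ => (hS.pow k).mono h) (by positivity)

theorem abs_cesaro_le (hS : IsPositive S) (hSe : S e = e) (he : 0 ≤ e) {f : E} {k : ℝ} (hk : 0 ≤ k)
    (h : |f| ≤ k • e) (n : ℕ) : |cesaro S f n| ≤ k • e := by
  have hke : S (k • e) = k • e := by rw [map_smul, hSe]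
  rcases eq_or_ne n 0 with rfl | hn
  · simpa [cesaro] using smul_nonneg hk he
  · rw [abs_le'] at h ⊢
    rw [← cesaro_neg, ← cesaro_of_map_eq hke hn]
    exact ⟨cesaro_mono hS h.1 n, cesaro_mono hS h.2 n⟩

theorem cesaro_bounded (hS : IsPositive S) (hSe : S e = e) (he : 0 ≤ e) {f : E}
    (hf : f ∈ bounded e) (n : ℕ) : cesaro S f n ∈ bounded e := by
  obtain ⟨k, hk, h⟩ := hf
  exact ⟨k, hk, abs_cesaro_le hS hSe he hk h n⟩

/-- Telescoping leaves only the end terms; for bounded `f` the error is of order `1/n`. -/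
theorem map_cesaro (f : E) (n : ℕ) :
    S (cesaro S f n) = cesaro S f n + (n : ℝ)⁻¹ • ((S ^ n) f - f) := by
  rw [cesaro, map_smul, ← smul_add, map_sum]
  congr 1
  have h := Finset.sum_range_succ' (fun k => (S ^ k) f) n
  rw [Finset.sum_range_succ] at h
  have h' : ∑ k ∈ Finset.range n, S ((S ^ k) f) = ∑ k ∈ Finset.range n, (S ^ (k + 1)) f :=
    Finset.sum_congr rfl fun k _ => by rw [pow_succ']; rfl
  rw [h', ← sub_eq_zero, ← sub_eq_zero.2 h.symm]
  simp
  abel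

end Cesaro

/-! ### The maximal ergodic theorem. -/

section MaximalInequality

/-- `maximalSum S h N` is the maximum of `0` and the sums `∑ k < n, S ^ k h` with `n ≤ N`. -/
def maximalSum (S : E →ₗ[ℝ] E) (h : E) : ℕ → E
  | 0 => 0
  | N + 1 => (h + S (maximalSum S h N))⁺

variable {T S : E →ₗ[ℝ] E} {e : E}

theorem maximalSum_nonneg (h : E) (N : ℕ) : 0 ≤ maximalSum S h N := by
  cases N with
  | zero => exact le_rfl
  | succ N => exact posPart_nonneg _

theorem maximalSum_le_succ (hS : IsPositive S) (h : E) (N : ℕ) :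
    maximalSum S h N ≤ maximalSum S h (N + 1) := by
  induction N with
  | zero => exact maximalSum_nonneg h 1
  | succ N ih => exact posPart_mono (add_le_add_right (hS.mono ih) h)

theorem maximalSum_bounded (hS : IsPositive S) (hSe : S e = e) {h : E}
    (hh : h ∈ bounded e) (N : ℕ) : maximalSum S h N ∈ bounded e := by
  induction N with
  | zero => exact ⟨0, le_rfl, by simp [maximalSum]⟩
  | succ N ih => exact posPart_bounded (bounded_add hh (hS.map_bounded hSe ih))

/-- It puts the negative part of `h + S (maximalSum S h N)` below that of the sum, which drives the
disjointness argument in `maximal_ergodic`. -/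
theorem sum_le_add_map_maximalSum (hS : IsPositive S) (h : E) (N : ℕ) :
    ∑ k ∈ Finset.range (N + 1), (S ^ k) h ≤ h + S (maximalSum S h N) := by
  induction N with
  | zero => simp [maximalSum]
  | succ N ih =>
    rw [Finset.sum_range_succ', add_comm]
    have h' : ∑ k ∈ Finset.range (N + 1), (S ^ (k + 1)) h =
        S (∑ k ∈ Finset.range (N + 1), (S ^ k) h) := by
      rw [map_sum]
      exact Finset.sum_congr rfl fun k _ => by rw [pow_succ']; rfl
    rw [h', pow_zero, Module.End.one_apply]
    exact add_le_add_right (hS.mono (ih.trans (le_posPart _))) h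

/-- The maximal ergodic theorem, in the form: if the supremum of the Cesàro means of `h`
dominates `ε • e` for some `ε > 0`, then `T h ≥ 0`. -/
theorem maximal_ergodic (hsys : IsCondExpPreservingSystem T S e) {h : E} (hh : h ∈ bounded e)
    {ε : ℝ} (hε : 0 < ε) {X : E} (hX : IsLUB (Set.range fun n : ℕ => cesaro S h (n + 1)) X)
    (hεX : ε • e ≤ X) : 0 ≤ T h := by
  have he := hsys.weakOrderUnit.1
  have hS := hsys.S_positive
  set G : ℕ → E := fun N => (h + S (maximalSum S h N))⁻ with hG
  have hanti : Antitone G := antitone_nat_of_succ_le fun N =>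
    negPart_anti (add_le_add_right (hS.mono (maximalSum_le_succ hS h N)) h)
  -- Apply `T` to `M N ≤ M (N + 1) = h + S (M N) + G N`, where `M = maximalSum S h`, and cancel `T
  -- (S (M N)) = T (M N)`.
  have hTG : ∀ N, -T h ≤ T (G N) := by
    intro N
    have hM := hsys.condExp.positive.mono (maximalSum_le_succ hS h N)
    have h1 : maximalSum S h (N + 1) = h + S (maximalSum S h N) + G N := by
      rw [hG, maximalSum]
      exact (sub_eq_iff_eq_add.1 (posPart_sub_negPart _))
    rw [h1, map_add, map_add,
      hsys.condExp_map_eq (maximalSum_bounded hS hsys.S_unit hh N)] at hM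
    rw [← sub_nonneg] at hM ⊢
    exact hM.trans_eq (by abel)
  -- If `b` is below every `G N`, then `b⁺` is disjoint from the positive part of every mean. As the
  -- means have supremum at least `ε • e`, this leaves no room for `b⁺`.
  have hglb : IsGLB (Set.range G) 0 := by
    refine ⟨by rintro _ ⟨N, rfl⟩; exact negPart_nonneg _, fun b hb => ?_⟩
    have hdN : ∀ N, b⁺ ≤ G N := fun N => sup_le (hb ⟨N, rfl⟩) (negPart_nonneg _)
    set w := b⁺ ⊓ ε • e with hw
    have hw0 : 0 ≤ w := le_inf (posPart_nonneg b) (smul_nonneg hε.le he)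
    have hwX : w ≤ X := inf_le_right.trans hεX
    have hdis : ∀ n : ℕ, (cesaro S h (n + 1))⁺ ⊓ w = 0 := by
      intro n
      set s := ∑ k ∈ Finset.range (n + 1), (S ^ k) h with hs
      have hn : (0 : ℝ) ≤ ((n + 1 : ℕ) : ℝ)⁻¹ := by positivity
      have h1 : w ≤ (1 : ℝ) • s⁻ := by
        rw [one_smul]
        exact inf_le_left.trans ((hdN n).trans (negPart_anti (sum_le_add_map_maximalSum hS h n)))
      have h2 : (cesaro S h (n + 1))⁺ ≤ ((n + 1 : ℕ) : ℝ)⁻¹ • s⁺ :=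
        sup_le (smul_le_smul_of_nonneg_left (le_posPart s) hn) (smul_nonneg hn (posPart_nonneg s))
      refine le_antisymm ((inf_le_inf h2 h1).trans_eq
        (smul_inf_smul_eq_zero' (posPart_inf_negPart_eq_zero s) hn zero_le_one))
        (le_inf (posPart_nonneg _) hw0)
    have hw_le : w ≤ 0 := by
      -- For disjoint elements sum and supremum agree, so each mean plus `w` is still at most `X`.
      have : X ≤ X - w := by
        refine hX.2 ?_
        rintro _ ⟨n, rfl⟩
        rw [le_sub_iff_add_le]
        calc cesaro S h (n + 1) + w ≤ (cesaro S h (n + 1))⁺ + w := add_le_add_left (le_posPart _) w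
          _ = (cesaro S h (n + 1))⁺ ⊔ w := by rw [← inf_add_sup, hdis n, zero_add]
          _ ≤ X := sup_le (sup_le (hX.1 ⟨n, rfl⟩) ((smul_nonneg hε.le he).trans hεX)) hwX
      simpa using this
    have hdisj : e ⊓ b⁺ = 0 := by
      have h1 := smul_inf_smul_eq_zero' ((inf_comm (ε • e) b⁺).trans (le_antisymm hw_le hw0))
        (inv_nonneg.2 hε.le) zero_le_one
      rwa [inv_smul_smul₀ hε.ne', one_smul] at h1
    have := hsys.weakOrderUnit.2 b⁺ (posPart_nonneg b) hdisj
    exact (le_posPart b).trans this.le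
  have hc := hsys.condExp.orderContinuous (Set.range G) (Set.range_nonempty G)
    (directedOn_range.2 hanti.directed_ge) hglb
  refine neg_nonpos.1 (hc.2 ?_)
  rintro _ ⟨_, ⟨N, rfl⟩, rfl⟩
  exact hTG N

end MaximalInequality

/-! ### The limit superior of the means and the Birkhoff theorem. -/

section ErgodicTheorem

/-- The suprema of the tails of the Cesàro means. -/
noncomputable def tailSup (S : E →ₗ[ℝ] E) (f : E) (n : ℕ) : E := ⨆ m : ℕ, cesaro S f (n + m)

/-- The limit superior of the Cesàro means. -/
noncomputable def limsupCesaro (S : E →ₗ[ℝ] E) (f : E) : E := ⨅ n : ℕ, tailSup S f n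

variable {T S : E →ₗ[ℝ] E} {e : E}

theorem isLUB_tailSup (hS : IsPositive S) (hSe : S e = e) (he : 0 ≤ e) {f : E}
    (hf : f ∈ bounded e) (n : ℕ) :
    IsLUB (Set.range fun m : ℕ => cesaro S f (n + m)) (tailSup S f n) := by
  obtain ⟨k, hk, h⟩ := hf
  exact isLUB_ciSup ⟨k • e, by
    rintro _ ⟨m, rfl⟩; exact (le_abs_self _).trans (abs_cesaro_le hS hSe he hk h _)⟩

theorem cesaro_le_tailSup (hS : IsPositive S) (hSe : S e = e) (he : 0 ≤ e) {f : E}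
    (hf : f ∈ bounded e) {n m : ℕ} (h : n ≤ m) : cesaro S f m ≤ tailSup S f n :=
  (isLUB_tailSup hS hSe he hf n).1 ⟨m - n, by simp [h]⟩

theorem tailSup_antitone (hS : IsPositive S) (hSe : S e = e) (he : 0 ≤ e) {f : E}
    (hf : f ∈ bounded e) : Antitone (tailSup S f) := fun _ _ h =>
  ciSup_le fun _ => cesaro_le_tailSup hS hSe he hf (h.trans (Nat.le_add_right _ _))

theorem isGLB_limsupCesaro (hS : IsPositive S) (hSe : S e = e) (he : 0 ≤ e) {f : E}
    (hf : f ∈ bounded e) : IsGLB (Set.range (tailSup S f)) (limsupCesaro S f) := by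
  obtain ⟨k, hk, h⟩ := id hf
  refine isGLB_ciInf ⟨-(k • e), ?_⟩
  rintro _ ⟨n, rfl⟩
  exact (neg_le.1 ((neg_le_abs _).trans (abs_cesaro_le hS hSe he hk h n))).trans
    (cesaro_le_tailSup hS hSe he hf le_rfl)

theorem limsupCesaro_bounded (hS : IsPositive S) (hSe : S e = e) (he : 0 ≤ e) {f : E}
    (hf : f ∈ bounded e) : limsupCesaro S f ∈ bounded e := by
  obtain ⟨k, hk, h⟩ := id hf
  have hglb := isGLB_limsupCesaro hS hSe he hf
  refine ⟨k, hk, abs_le'.2 ⟨(hglb.1 ⟨0, rfl⟩).trans (ciSup_le fun m =>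
    (le_abs_self _).trans (abs_cesaro_le hS hSe he hk h _)), neg_le.1 (hglb.2 ?_)⟩⟩
  rintro _ ⟨n, rfl⟩
  exact (neg_le.1 ((neg_le_abs _).trans (abs_cesaro_le hS hSe he hk h n))).trans
    (cesaro_le_tailSup hS hSe he hf le_rfl)

/-- By `map_cesaro`, applying `S` lowers a tail supremum by at most a vanishing multiple of `e`.
Order continuity of `S` then gives `l ≤ S l`, and `T (S l) = T l` makes this an equality. -/
theorem map_limsupCesaro (hsys : IsCondExpPreservingSystem T S e) (hT : IsStrictlyPositive T)
    {f : E} (hf : f ∈ bounded e) : S (limsupCesaro S f) = limsupCesaro S f := by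
  have he := hsys.weakOrderUnit.1
  have hS := hsys.S_positive
  have hSe := hsys.S_unit
  obtain ⟨k, hk, h⟩ := id hf
  have hglb := isGLB_limsupCesaro hS hSe he hf
  set l := limsupCesaro S f with hl
  have hstep : ∀ n : ℕ, tailSup S f (n + 1) - (2 * k / (n + 1 : ℕ)) • e ≤
      S (tailSup S f (n + 1)) := by
    intro n
    rw [sub_le_iff_le_add]
    refine ciSup_le fun m => ?_
    set p := n + 1 + m with hp
    have hp0 : (0 : ℝ) < p := by rw [hp]; positivity
    have h1 := hS.mono (cesaro_le_tailSup hS hSe he hf (Nat.le_add_right (n + 1) m))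
    rw [← hp, map_cesaro] at h1
    have h2 : -((2 * k / (n + 1 : ℕ)) • e) ≤ (p : ℝ)⁻¹ • ((S ^ p) f - f) := by
      have h3 : -((2 * k) • e) ≤ (S ^ p) f - f := by
        have h4 : -(k • e) ≤ (S ^ p) f := by
          have := (hS.pow p).mono (neg_le.1 ((neg_le_abs f).trans h))
          rwa [map_neg, map_smul, pow_apply_of_eq hSe] at this
        have h5 : f ≤ k • e := (le_abs_self f).trans h
        calc -((2 * k) • e) = -(k • e) - k • e := by module
          _ ≤ _ := sub_le_sub h4 h5
      refine le_trans ?_ (smul_le_smul_of_nonneg_left h3 (inv_nonneg.2 hp0.le))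
      rw [smul_neg, smul_smul]
      refine neg_le_neg (smul_le_smul_of_nonneg_right ?_ he)
      rw [inv_mul_eq_div]
      exact div_le_div_of_nonneg_left (by positivity) (by positivity)
        (by rw [hp]; push_cast; linarith [(Nat.cast_nonneg m : (0 : ℝ) ≤ m)])
    have h6 := (add_le_add_right h2 (cesaro S f p)).trans h1
    rwa [← sub_eq_add_neg, sub_le_iff_le_add] at h6
  have hge : ∀ n, l ≤ S (tailSup S f n) := by
    intro n
    rw [← sub_nonpos]
    refine nonpos_of_forall_le_smul he fun ε hε => ?_
    obtain ⟨N, hN⟩ := exists_nat_gt (2 * k / ε)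
    have hle : n ≤ max n N + 1 := (le_max_left n N).trans (Nat.le_succ _)
    have h1 := (hstep (max n N)).trans (hS.mono (tailSup_antitone hS hSe he hf hle))
    have h2 : l ≤ tailSup S f (max n N + 1) := hglb.1 ⟨_, rfl⟩
    have h3 : (2 * k / (max n N + 1 : ℕ)) • e ≤ ε • e := by
      refine smul_le_smul_of_nonneg_right ?_ he
      have h4 : (N : ℝ) ≤ (max n N + 1 : ℕ) := by
        exact_mod_cast (le_max_right n N).trans (Nat.le_succ _)
      have h5 := (div_lt_iff₀ hε).1 (hN.trans_le h4)
      rw [div_le_iff₀ (by positivity)]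
      linarith
    rw [sub_le_iff_le_add']
    exact h2.trans ((sub_le_iff_le_add.1 h1).trans (add_le_add_right h3 _))
  have hSl : l ≤ S l := by
    have hglb0 : IsGLB (Set.range fun n => tailSup S f n - l) 0 := by
      refine ⟨by rintro _ ⟨n, rfl⟩; exact sub_nonneg.2 (hglb.1 ⟨n, rfl⟩), fun b hb => ?_⟩
      have : l + b ≤ l := hglb.2 <| by
        rintro _ ⟨n, rfl⟩
        exact le_sub_iff_add_le'.1 (hb ⟨n, rfl⟩)
      simpa using this
    have hanti : Antitone fun n => tailSup S f n - l := fun m n hmn =>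
      sub_le_sub_right (tailSup_antitone hS hSe he hf hmn) l
    have hc := hsys.S_orderContinuous _ (Set.range_nonempty _)
      (directedOn_range.2 hanti.directed_ge) hglb0
    rw [← sub_nonpos]
    refine hc.2 ?_
    rintro _ ⟨_, ⟨n, rfl⟩, rfl⟩
    rw [map_sub]
    exact sub_le_sub_right (hge n) _
  exact (hT.eq_of_le hSl
    (hsys.condExp_map_eq (limsupCesaro_bounded hS hSe he hf)).le).symm

theorem map_limsupCesaro_le (hsys : IsCondExpPreservingSystem T S e) (hT : IsStrictlyPositive T)
    {f : E} (hf : f ∈ bounded e) : T (limsupCesaro S f) ≤ T f := by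
  have he := hsys.weakOrderUnit.1
  have hS := hsys.S_positive
  have hSe := hsys.S_unit
  have hSl := map_limsupCesaro hsys hT hf
  have hlb := limsupCesaro_bounded hS hSe he hf
  have hglb := isGLB_limsupCesaro hS hSe he hf
  set l := limsupCesaro S f
  rw [← sub_nonpos]
  refine nonpos_of_forall_le_smul he fun ε hε => ?_
  -- As `c` is invariant, the means of `f + c` are those of `f` shifted by `c`; their supremum is at
  -- least `l + c = ε • e`, so `T (f + c) ≥ 0`.
  set c := ε • e - l with hc
  have hcb : c ∈ bounded e := bounded_sub (bounded_smul ε (unit_bounded he)) hlb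
  have hSc : S c = c := by rw [hc, map_sub, map_smul, hSe, hSl]
  have hlub : IsLUB (Set.range fun n : ℕ => cesaro S (f + c) (n + 1)) (tailSup S f 1 + c) := by
    have h1 := isLUB_tailSup hS hSe he hf 1
    have h2 : ∀ n : ℕ, cesaro S (f + c) (n + 1) = cesaro S f (1 + n) + c := fun n => by
      rw [cesaro_add, cesaro_of_map_eq hSc n.succ_ne_zero, add_comm 1]
    refine ⟨?_, fun b hb => ?_⟩
    · rintro _ ⟨n, rfl⟩
      exact (h2 n).trans_le (add_le_add_left (h1.1 ⟨n, rfl⟩) c)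
    · rw [← le_sub_iff_add_le]
      refine h1.2 ?_
      rintro _ ⟨n, rfl⟩
      rw [le_sub_iff_add_le, ← h2]
      exact hb ⟨n, rfl⟩
  have h := maximal_ergodic hsys (bounded_add hf hcb) hε hlub <| by
    have : l ≤ tailSup S f 1 := hglb.1 ⟨1, rfl⟩
    calc ε • e = l + c := by rw [hc]; abel
      _ ≤ _ := add_le_add_left this c
  rw [hc, map_add, map_sub, map_smul, hsys.T_unit] at h
  rw [← sub_nonneg]
  exact h.trans_eq (by abel)

/-- In an ergodic system, the Cesàro means of `f` converge in order to `T f`. -/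
theorem orderTendsto_cesaro (hsys : IsCondExpPreservingSystem T S e) (hT : IsStrictlyPositive T)
    (herg : ∀ f, S f = f → T f = f) {f : E} (hf : f ∈ bounded e) :
    OrderTendsto (cesaro S f) (T f) := by
  have he := hsys.weakOrderUnit.1
  have hS := hsys.S_positive
  have hSe := hsys.S_unit
  have hle : ∀ f ∈ bounded e, limsupCesaro S f ≤ T f := fun f hf => by
    rw [← herg _ (map_limsupCesaro hsys hT hf)]
    exact map_limsupCesaro_le hsys hT hf
  have hf' := bounded_neg hf
  have h1 := hle f hf
  have h2 := hle (-f) hf'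
  rw [map_neg] at h2
  have hanti := tailSup_antitone hS hSe he hf
  have hanti' := tailSup_antitone hS hSe he hf'
  have hglb := isGLB_limsupCesaro hS hSe he hf
  have hglb' := isGLB_limsupCesaro hS hSe he hf'
  have hsum : ∀ n, 0 ≤ tailSup S f n + tailSup S (-f) n := fun n => by
    have := add_le_add (cesaro_le_tailSup hS hSe he hf (le_refl n))
      (cesaro_le_tailSup hS hSe he hf' (le_refl n))
    rwa [cesaro_neg, add_neg_cancel] at this
  have hall : ∀ b, (∀ n, b ≤ tailSup S f n + tailSup S (-f) n) →
      b ≤ limsupCesaro S f + limsupCesaro S (-f) := by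
    intro b hb
    rw [← sub_le_iff_le_add]
    refine hglb.2 ?_
    rintro _ ⟨m, rfl⟩
    rw [sub_le_comm]
    refine hglb'.2 ?_
    rintro _ ⟨n, rfl⟩
    rw [sub_le_iff_le_add']
    exact (hb (max m n)).trans (add_le_add (hanti (le_max_left m n)) (hanti' (le_max_right m n)))
  have h3 : limsupCesaro S f + limsupCesaro S (-f) ≤ 0 :=
    (add_le_add h1 h2).trans_eq (add_neg_cancel _)
  have h4 : T f ≤ limsupCesaro S f := by
    have := (hall 0 hsum).trans (add_le_add_right h2 _)
    rwa [← sub_eq_add_neg, sub_nonneg] at this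
  have h5 : -T f ≤ limsupCesaro S (-f) := by
    have := (hall 0 hsum).trans (add_le_add_left h1 _)
    exact neg_le_iff_add_nonneg'.2 this
  -- The dominating sequence is the oscillation of the tail: its supremum minus its infimum.
  refine ⟨fun n => tailSup S f n + tailSup S (-f) n, fun m n hmn =>
    add_le_add (hanti hmn) (hanti' hmn), ⟨?_, fun b hb => ?_⟩, Eventually.of_forall fun n => ?_⟩
  · rintro _ ⟨n, rfl⟩
    exact hsum n
  · exact (hall b fun n => hb ⟨n, rfl⟩).trans h3
  · have h6 : T f ≤ tailSup S f n := h4.trans (hglb.1 ⟨n, rfl⟩)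
    have h7 : -T f ≤ tailSup S (-f) n := h5.trans (hglb'.1 ⟨n, rfl⟩)
    have h8 := cesaro_le_tailSup hS hSe he hf' (le_refl n)
    rw [cesaro_neg] at h8
    refine abs_le'.2 ⟨?_, ?_⟩
    · rw [sub_eq_add_neg]
      exact add_le_add (cesaro_le_tailSup hS hSe he hf le_rfl) h7
    · rw [neg_sub, sub_eq_add_neg]
      exact add_le_add h6 h8

end ErgodicTheorem

/-! ### Invariant elements and the mixing condition. -/

section Mixing

variable {T S : E →ₗ[ℝ] E} {e : E}

theorem isErgodic_iff (hTT : ∀ x, T (T x) = T x) :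
    IsErgodic T S ↔ ∀ f, S f = f → T f = f := by
  have hlim : ∀ f, S f = f → OrderTendsto (cesaro S f) f := fun f hf =>
    orderTendsto_of_eventuallyEq <| by
      filter_upwards [eventually_ne_atTop 0] with n hn using cesaro_of_map_eq hf hn
  refine ⟨fun h f hf => ?_, fun h f hf => ⟨f, ⟨f, h f hf⟩, hlim f hf⟩⟩
  obtain ⟨_, ⟨x, rfl⟩, hx⟩ := h f hf
  rw [(hlim f hf).unique hx, hTT]

theorem eMul_cesaro (hS : IsPositive S) (hSe : S e = e) (he : 0 ≤ e) {f g : E}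
    (hf : f ∈ bounded e) (hg : g ∈ bounded e) (n : ℕ) :
    eMul e (cesaro S f n) g = (n : ℝ)⁻¹ • ∑ k ∈ Finset.range n, eMul e ((S ^ k) f) g := by
  have hk : ∀ k, (S ^ k) f ∈ bounded e := fun k =>
    (hS.pow k).map_bounded (pow_apply_of_eq hSe k) hf
  have hsum : (∑ k ∈ Finset.range n, (S ^ k) f) ∈ bounded e ∧
      eMul e (∑ k ∈ Finset.range n, (S ^ k) f) g =
        ∑ k ∈ Finset.range n, eMul e ((S ^ k) f) g := by
    induction n with
    | zero => exact ⟨⟨0, le_rfl, by simp⟩, by simp [zero_eMul]⟩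
    | succ n ih =>
      rw [Finset.sum_range_succ, Finset.sum_range_succ, eMul_add_left he ih.1 (hk n) hg, ih.2]
      exact ⟨bounded_add ih.1 (hk n), rfl⟩
  rw [cesaro, eMul_smul_left he hsum.1 hg, hsum.2]

theorem map_eq_of_eMul (hsys : IsCondExpPreservingSystem T S e) (hT : IsStrictlyPositive T)
    {f : E} (hf : f ∈ bounded e)
    (h : ∀ g ∈ bounded e, T (eMul e f g) = eMul e (T f) (T g)) : T f = f := by
  have he := hsys.weakOrderUnit.1
  have hTT := hsys.condExp.projection
  have hTf := hT.1.map_bounded hsys.T_unit hf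
  have hd := bounded_sub hf hTf
  -- Using `h` with `g = f` and `g = T f`, every term of the expanded square has image `T f · T f`
  -- under `T`, and the signs cancel.
  have hsq : T (eSq e (f - T f)) = 0 := by
    rw [← eMul_self he hd, eMul_sub_left he hf hTf hd, eMul_sub_right he hf hTf hf,
      eMul_sub_right he hf hTf hTf, eMul_comm e (T f) f, map_sub, map_sub, map_sub, h f hf,
      h _ hTf, hTT, map_eMul_of_map_eq he hT hsys.T_unit hTT hTf hTf (hTT f), hTT]
    abel
  have h0 := (hT.2 _ (eSq_nonneg he hd)).1 hsq
  exact (sub_eq_zero.1 (eq_zero_of_eSq_eq_zero he hd h0)).symm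

/-- For `f ≥ 0` the truncations `f ⊓ n e` are invariant, hence fixed by `T` and below `T f`. So `f ≤
T f`, with equality because both have the same image under `T`. -/
theorem map_eq_of_bounded (hsys : IsCondExpPreservingSystem T S e) (hT : IsStrictlyPositive T)
    (h : ∀ f ∈ bounded e, S f = f → T f = f) {f : E} (hf : S f = f) : T f = f := by
  have he := hsys.weakOrderUnit.1
  have key : ∀ f, 0 ≤ f → S f = f → T f = f := by
    intro f hf0 hf
    refine (hT.eq_of_le (le_of_forall_inf_smul_le hsys.weakOrderUnit fun n => ?_)
      (hsys.condExp.projection f).le).symm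
    have hne : (0 : E) ≤ (n : ℝ) • e := smul_nonneg n.cast_nonneg he
    have hb : f ⊓ (n : ℝ) • e ∈ bounded e :=
      ⟨n, n.cast_nonneg, by rw [abs_of_nonneg (le_inf hf0 hne)]; exact inf_le_right⟩
    have hinf : S (f ⊓ (n : ℝ) • e) = f ⊓ (n : ℝ) • e := by
      have h1 : f ⊓ (n : ℝ) • e = f + (n : ℝ) • e - f ⊔ (n : ℝ) • e :=
        eq_sub_of_add_eq (inf_add_sup _ _)
      rw [h1, map_sub, map_add, hsys.S_latticeHom, map_smul, hf, hsys.S_unit]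
    rw [← h _ hb hinf]
    exact hT.1.mono inf_le_left
  have hp : S f⁺ = f⁺ := by
    rw [posPart_def, hsys.S_latticeHom, hf, map_zero]
  have hn : S f⁻ = f⁻ := by
    rw [negPart_def, hsys.S_latticeHom, map_neg, hf, map_zero]
  rw [← posPart_sub_negPart f, map_sub, key _ (posPart_nonneg f) hp, key _ (negPart_nonneg f) hn]

end Mixing

end RieszErgodic

theorem theorem3p5 {E : Type*} [ConditionallyCompleteLattice E] [AddCommGroup E]
    [IsOrderedAddMonoid E] [Module ℝ E] [IsOrderedModule ℝ E]
    (T S : E →ₗ[ℝ] E) (e : E)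
    (hsys : RieszErgodic.IsCondExpPreservingSystem T S e)
    (hT : RieszErgodic.IsStrictlyPositive T) :
    RieszErgodic.IsErgodic T S ↔
      ∀ f ∈ RieszErgodic.bounded e, ∀ g ∈ RieszErgodic.bounded e,
        RieszErgodic.OrderTendsto
          (fun n : ℕ => (n : ℝ)⁻¹ •
            ∑ k ∈ Finset.range n, T (RieszErgodic.eMul e ((S ^ k) f) g))
          (RieszErgodic.eMul e (T f) (T g)) := by
  have he := hsys.weakOrderUnit.1
  have hS := hsys.S_positive
  have hTT := hsys.condExp.projection
  rw [RieszErgodic.isErgodic_iff hTT]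
  constructor
  · intro herg f hf g hg
    have hTf := hT.1.map_bounded hsys.T_unit hf
    have hlim := (RieszErgodic.eMul_orderTendsto he
      (RieszErgodic.cesaro_bounded hS hsys.S_unit he hf) hTf hg
      (RieszErgodic.orderTendsto_cesaro hsys hT herg hf)).map hT.1 hsys.condExp.orderContinuous
    rw [RieszErgodic.eMul_comm e (T f) g,
      RieszErgodic.map_eMul_of_map_eq he hT hsys.T_unit hTT hg hTf (hTT f),
      RieszErgodic.eMul_comm e (T g) (T f)] at hlim
    simpa only [RieszErgodic.eMul_cesaro hS hsys.S_unit he hf hg, map_smul, map_sum] using hlim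
  · intro hmix f hSf
    refine RieszErgodic.map_eq_of_bounded hsys hT (fun f hf hSf => ?_) hSf
    refine RieszErgodic.map_eq_of_eMul hsys hT hf fun g hg => ?_
    -- All summands equal `T (f · g)`, so the averages are constant for `n ≠ 0`; uniqueness of order
    -- limits identifies this value with `T f · T g`.
    refine (RieszErgodic.orderTendsto_of_eventuallyEq ?_).unique (hmix f hf g hg)
    filter_upwards [eventually_ne_atTop 0] with n hn
    have hn' : (n : ℝ) ≠ 0 := by exact_mod_cast hn
    simp only [RieszErgodic.pow_apply_of_eq hSf, Finset.sum_const, Finset.card_range]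
    rw [← Nat.cast_smul_eq_nsmul ℝ, inv_smul_smul₀ hn']
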